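/- Let $\mathbb F_q$ be a finite field, $\mathcal A=\mathbb F_q^k$, $\mathcal E$ a finite set, and $P=P_{A,E}$ a probability distribution on $\mathcal A\times\mathcal E$ with conditional entropy $H=H(A|E|P)=H(A,E)-H(E)$ (natural logarithms) and varentropy $$V(P)=\sum_{a,e}P_{A,E}(a,e)\bigl(-\log P_{A|E}(a|e)-H\bigr)^2>0 .$$ Let $(A_n,E_n)$ have the law $P_{A,E}^n$ on $\mathcal A^n\times\mathcal E^n$. For a function $f$ from $\mathcal A^n$ to a finite set $\mathcal B$ put $$d_1'(f(A_n)|E_n)=\sum_{b\in\mathcal B}\sum_{e\in\mathcal E^n}\bigl|P_{f(A_n),E_n}(b,e)-|\mathcal B|^{-1}P_{E_n}(e)\bigr| .$$ A random linear function $f_{X}:\mathbb F_q^N\to\mathbb F_q^m$ is called $\varepsilon$-almost dual universal$_2$ if $\Pr[x\in(\ker f_{X})^\perp]\le \varepsilon\,q^{m-N}$ for every $x\in\mathbb F_q^N\setminus\{0\}$, where $\perp$ is the dual code for the standard bilinear form. Let $R\in\mathbb R$, let $p(n)$ be a real polynomial, and let $m_n$ be natural numbers with $m_n\log q=nH+\sqrt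 n\,R+o(\sqrt n)$ (for instance the largest $m_n$ with $q^{m_n}\le e^{nH+\sqrt n R}$). For each $n$ let $f_{X^n}$ be a $p(n)$-almost dual universal$_2$ random linear function from $\mathcal A^n=\mathbb F_q^{kn}$ to $\mathbb F_q^{m_n}$, and suppose that $\Pr[f_{X^n}\text{ is surjective}]\to1$ (for instance that $f_{X^n}$ is always surjective). Then $$\lim_{n\to\infty}\mathrm E_{X^n}\,d_1'(f_{X^n}(A_n)|E_n)=\lim_{n\to\infty}\min_f d_1'(f(A_n)|E_n)=2\int_{-\infty}^{R/\sqrt{V(P)}}\frac1{\sqrt{2\pi}}e^{-x^2/2}\,dx ,$$ where the minimum is over all functions $f$ from $\mathcal A^n$ to $\{1,\dots,\lfloor e^{nH+\sqrt nR}\rfloor\}$; the second equality also holds with the minimum over all functions $f$ from $\mathcal A^n$ to $\mathbb F_q^{m_n}$. -/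

import Mathlib

open MeasureTheory Filter Topology

namespace KeyHash

noncomputable section

/-! ### Information quantities of a joint distribution `P` on finite sets (natural logarithms) -/

section Information

variable {𝒜 ℰ : Type*} [Fintype 𝒜]

/-- The marginal distribution `P_E(e) = ∑ₐ P(a, e)`. -/
def marginalE (P : 𝒜 → ℰ → ℝ) (e : ℰ) : ℝ := ∑ a, P a e

/-- The conditional probability `P_{A|E}(a|e) = P(a, e) / P_E(e)`. It is only used multiplied
by `P(a, e)`, which vanishes when `P_E(e) = 0`. -/
def condProb (P : 𝒜 → ℰ → ℝ) (a : 𝒜) (e : ℰ) : ℝ := P a e / marginalE P e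

variable [Fintype ℰ]

/-- The conditional entropy `H(A|E) = H(A, E) - H(E)`. -/
def condEntropy (P : 𝒜 → ℰ → ℝ) : ℝ :=
  (∑ a, ∑ e, Real.negMulLog (P a e)) - ∑ e, Real.negMulLog (marginalE P e)

/-- The varentropy `V(P) = ∑ P(a, e) (- log P_{A|E}(a|e) - H(A|E))²`. -/
def varentropy (P : 𝒜 → ℰ → ℝ) : ℝ :=
  ∑ a, ∑ e, P a e * (-Real.log (condProb P a e) - condEntropy P) ^ 2

/-- The `L₁` distinguishability criterion
`d₁'(A|E|P) = ‖P_{A,E} - P_{mix,𝒜} × P_E‖₁`, where `P_{mix,𝒜}` is uniform on `𝒜`. -/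
def d1' (P : 𝒜 → ℰ → ℝ) : ℝ :=
  ∑ a, ∑ e, |P a e - 1 / (Fintype.card 𝒜 : ℝ) * marginalE P e|

end Information

/-- The joint distribution `P_{f(A),E}` of the key `f(A)` and `E`. -/
def keyDist {𝒜 ℬ ℰ : Type*} [Fintype 𝒜] (f : 𝒜 → ℬ) (P : 𝒜 → ℰ → ℝ) (b : ℬ) (e : ℰ) : ℝ :=
  open Classical in ∑ a, if f a = b then P a e else 0

/-- The `n`-fold independent and identical distribution `P_{A,E}^n` on `𝒜ⁿ × ℰⁿ`. -/
def iidDist {𝒜 ℰ : Type*} (P : 𝒜 → ℰ → ℝ) (n : ℕ) (a : Fin n → 𝒜) (e : Fin n → ℰ) : ℝ :=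
  ∏ i, P (a i) (e i)

/-- The optimal value `min_f d₁'(f(A)|E|P)` over all functions `f : 𝒜 → ℬ`. -/
def minD1' {𝒜 ℰ : Type*} (ℬ : Type*) [Fintype 𝒜] [Fintype ℬ] [Fintype ℰ]
    (P : 𝒜 → ℰ → ℝ) : ℝ :=
  ⨅ f : 𝒜 → ℬ, d1' (keyDist f P)

/-! ### Random codes and random linear hash functions over a finite field `F` with `q` elements

The alphabet is `𝒜 = F^k`, so that `𝒜ⁿ = Fin n → Fin k → F` is `F^(nk)`. -/

section Codes

variable {F : Type*} [Field F] {n k : ℕ}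

/-- The dual code `C^⊥` for the standard bilinear form on `F^(nk)`. -/
def dualCode (C : Submodule F (Fin n → Fin k → F)) : Submodule F (Fin n → Fin k → F) where
  carrier := {y | ∀ x ∈ C, ∑ i, ∑ j, x i j * y i j = 0}
  zero_mem' := by
    intro x _
    simp
  add_mem' := by
    intro y z hy hz x hx
    have h1 := hy x hx
    have h2 := hz x hx
    simp only [Pi.add_apply, mul_add, Finset.sum_add_distrib]
    rw [h1, h2, add_zero]
  smul_mem' := by
    intro c y hy x hx
    have h1 := hy x hx
    have h2 : ∑ i, ∑ j, x i j * (c • y) i j = c * ∑ i, ∑ j, x i j * y i j := by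
      simp only [Pi.smul_apply, smul_eq_mul, Finset.mul_sum]
      exact Finset.sum_congr rfl fun i _ => Finset.sum_congr rfl fun j _ => by ring
    rw [h2, h1, mul_zero]

variable [Fintype F] {Ω : Type*} [MeasurableSpace Ω]

/-- The random code `C` in `F^(nk)` is `ε`-almost universal₂ with maximum dimension `t`:
`Pr[x ∈ C] ≤ q^(t - nk) ε` for every `x ≠ 0`. -/
def IsAlmostUniversalCode (μ : Measure Ω) (C : Ω → Submodule F (Fin n → Fin k → F))
    (t : ℤ) (ε : ℝ) : Prop :=
  (∀ ω, (Module.finrank F (C ω) : ℤ) ≤ t) ∧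
    ∀ x : Fin n → Fin k → F, x ≠ 0 →
      μ.real {ω | x ∈ C ω} ≤ (Fintype.card F : ℝ) ^ (t - (n * k : ℕ)) * ε

/-- The random code `C` in `F^(nk)` is `ε`-almost dual universal₂ with minimum dimension `t`:
the dual random code is `ε`-almost universal₂ with maximum dimension `nk - t`. -/
def IsAlmostDualUniversalCode (μ : Measure Ω) (C : Ω → Submodule F (Fin n → Fin k → F))
    (t : ℤ) (ε : ℝ) : Prop :=
  IsAlmostUniversalCode μ (fun ω => dualCode (C ω)) ((n * k : ℕ) - t) ε

/-- The random linear function `f` from `F^(nk)` to `F^m` is `ε`-almost dual universal₂: its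
kernels form an `ε`-almost dual universal₂ code with minimum dimension `nk - m`. -/
def IsAlmostDualUniversalHash {m : ℕ} (μ : Measure Ω)
    (f : Ω → (Fin n → Fin k → F) →ₗ[F] (Fin m → F)) (ε : ℝ) : Prop :=
  IsAlmostDualUniversalCode μ (fun ω => LinearMap.ker (f ω)) ((n * k : ℕ) - (m : ℤ)) ε

end Codes

end

end KeyHash

open KeyHash

/-! Distinguishability of a key of size `M` is governed by the mass of the pairs with `P_{A|E}(a|e)
≥ t`, for a threshold `t` near `1/M`.

Converse (`two_mul_largeMass_sub_le_d1'`): given `e`, at most `1/t` values `a` are that likely, so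
their images form a set of uniform mass at most `1/(Mt)`. Testing on this set gives `d₁' ≥ 2
(largeMass - 1/(Mt))` for every function.

Direct part (`sum_mul_d1'_truncDist_le`): removing the likely pairs costs at most twice their mass.
On the rest, Cauchy–Schwarz reduces `L₁` to a weighted `L₂` distance, and a mean square bound with
factor `ε` yields `√(ε M t)`. Uniformly random functions satisfy it with `ε = 1` because cross terms
cancel. For surjective linear functions it follows from Parseval: the Fourier coefficients of the
hashed weight are those of the original weight on the dual code of the kernel, and dual universality
bounds how often each is hit. Non-surjective outcomes cost at most `2` each, and their probability
tends to `0`.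

Taking `Mt = exp(±n^{1/4})` makes `1/(Mt)` and the polynomial times `Mt` vanish, while moving `-log
t` only by `o(√n)`. The central limit theorem for `-log P_{A|E}` (`tendsto_largeMass_iidDist`) then
gives both bounds the same limit. -/

namespace KeyHash

noncomputable section

/-! ### One-shot bounds: converse, truncation and leftover hashing -/

section OneShot

variable {𝒜 ℬ ℰ : Type*} [Fintype 𝒜] [Fintype ℬ] [Fintype ℰ]

/-- The image `b ↦ ∑_{f a = b} g a` of the weight `g` under `f`. -/
def pushSum (f : 𝒜 → ℬ) (g : 𝒜 → ℝ) (b : ℬ) : ℝ :=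
  open Classical in ∑ a, if f a = b then g a else 0

/-- The total mass of the pairs `(a, e)` with `t ≤ P_{A|E}(a|e)`. -/
def largeMass (P : 𝒜 → ℰ → ℝ) (t : ℝ) : ℝ :=
  open Classical in ∑ a, ∑ e, if t ≤ condProb P a e then P a e else 0

/-- The part of `P` on the pairs `(a, e)` with `P_{A|E}(a|e) < t`. -/
def truncDist (P : 𝒜 → ℰ → ℝ) (t : ℝ) (a : 𝒜) (e : ℰ) : ℝ :=
  open Classical in if t ≤ condProb P a e then 0 else P a e

omit [Fintype ℬ] [Fintype ℰ] in
theorem keyDist_eq_pushSum (f : 𝒜 → ℬ) (P : 𝒜 → ℰ → ℝ) (b : ℬ) (e : ℰ) :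
    keyDist f P b e = pushSum f (fun a => P a e) b := rfl

theorem sum_mul_pushSum (f : 𝒜 → ℬ) (g : 𝒜 → ℝ) (h : ℬ → ℝ) :
    ∑ b, h b * pushSum f g b = ∑ a, h (f a) * g a := by
  classical
  simp only [pushSum, Finset.mul_sum]
  rw [Finset.sum_comm]
  refine Finset.sum_congr rfl fun a _ => ?_
  simp

theorem sum_pushSum (f : 𝒜 → ℬ) (g : 𝒜 → ℝ) : ∑ b, pushSum f g b = ∑ a, g a := by
  simpa using sum_mul_pushSum f g (fun _ => 1)

omit [Fintype ℰ] in
theorem marginalE_keyDist (f : 𝒜 → ℬ) (P : 𝒜 → ℰ → ℝ) (e : ℰ) :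
    marginalE (keyDist f P) e = marginalE P e :=
  sum_pushSum f fun a => P a e

theorem sum_marginalE (P : 𝒜 → ℰ → ℝ) : ∑ e, marginalE P e = ∑ a, ∑ e, P a e := by
  simp only [marginalE]; exact Finset.sum_comm

-- Charges one unit of `P_E(e)` to a single likely `a`; summed over images, this replaces counting
-- the at most `1/t` likely values.
omit [Fintype ℰ] in
theorem marginalE_le_div {P : 𝒜 → ℰ → ℝ} (hP : ∀ a e, 0 ≤ P a e) {t : ℝ} (ht : 0 < t)
    (a : 𝒜) (e : ℰ) (h : t ≤ condProb P a e) : marginalE P e ≤ P a e / t := by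
  have h0 : 0 ≤ marginalE P e := Finset.sum_nonneg fun a _ => hP a e
  rw [le_div_iff₀ ht]
  rcases h0.eq_or_lt with h1 | h1
  · rw [← h1]; simpa using hP a e
  · rw [condProb, le_div_iff₀ h1] at h; linarith

/-- Converse: every key generating function has a distinguishability that is bounded from below
by the mass of the large conditional probabilities. -/
theorem two_mul_largeMass_sub_le_d1' {P : 𝒜 → ℰ → ℝ} (hP : ∀ a e, 0 ≤ P a e)
    (hP1 : ∑ a, ∑ e, P a e = 1) {t : ℝ} (ht : 0 < t) (f : 𝒜 → ℬ) :
    2 * (largeMass P t - 1 / (Fintype.card ℬ * t)) ≤ d1' (keyDist f P) := by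
  classical
  have hne : Nonempty ℬ := by
    by_contra h
    rw [not_nonempty_iff] at h
    have : IsEmpty 𝒜 := ⟨fun a => h.false (f a)⟩
    simp at hP1
  have hM : (0 : ℝ) < Fintype.card ℬ := by exact_mod_cast Fintype.card_pos
  set M : ℝ := (Fintype.card ℬ : ℝ) with hMdef
  set S : ℬ → ℰ → Prop := fun b e => ∃ a, f a = b ∧ t ≤ condProb P a e with hS
  set D : ℬ → ℰ → ℝ := fun b e => keyDist f P b e - 1 / M * marginalE P e with hD
  have hd : d1' (keyDist f P) = ∑ e, ∑ b, |D b e| := by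
    rw [d1', Finset.sum_comm]
    simp only [marginalE_keyDist, hD, hMdef]
  have hD0 : ∀ e, ∑ b, D b e = 0 := by
    intro e
    have h1 : ∑ b, keyDist f P b e = marginalE P e := marginalE_keyDist f P e
    simp only [hD, Finset.sum_sub_distrib, h1, Finset.sum_const, Finset.card_univ, nsmul_eq_mul,
      ← hMdef]
    field_simp
    ring
  have hmE : ∀ e, 0 ≤ marginalE P e := fun e => Finset.sum_nonneg fun a _ => hP a e
  -- For fixed `e` the test set is `S · e`, the image of the likely values. Since `D · e` sums to
  -- zero, its `L₁` norm is at least `2 D(S)`.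
  have hcol : ∀ e, 2 * ((∑ a, if t ≤ condProb P a e then P a e else 0) - marginalE P e / (M * t))
      ≤ ∑ b, |D b e| := by
    intro e
    have h1 : ∑ b, (2 * ((if S b e then 1 else 0) * D b e) - D b e) ≤ ∑ b, |D b e| := by
      refine Finset.sum_le_sum fun b _ => ?_
      split_ifs
      · linarith [le_abs_self (D b e)]
      · linarith [neg_abs_le (D b e)]
    rw [Finset.sum_sub_distrib, hD0, ← Finset.mul_sum] at h1
    have h2 : ∑ b, (if S b e then (1 : ℝ) else 0) * D b e
        = (∑ a, (if S (f a) e then (1 : ℝ) else 0) * P a e)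
          - 1 / M * ∑ b, if S b e then marginalE P e else 0 := by
      rw [← sum_mul_pushSum f (fun a => P a e) (fun b => if S b e then (1 : ℝ) else 0),
        Finset.mul_sum, ← Finset.sum_sub_distrib]
      refine Finset.sum_congr rfl fun b _ => ?_
      simp only [hD, keyDist_eq_pushSum]
      split_ifs <;> ring
    have h3 : (∑ a, if t ≤ condProb P a e then P a e else 0)
        ≤ ∑ a, (if S (f a) e then (1 : ℝ) else 0) * P a e := by
      refine Finset.sum_le_sum fun a _ => ?_
      by_cases h : t ≤ condProb P a e
      · have : S (f a) e := ⟨a, rfl, h⟩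
        simp [h, this]
      · simp only [h, if_false]
        exact mul_nonneg (by split_ifs <;> norm_num) (hP a e)
    -- Each `b` in the test set has a likely preimage, whose mass divided by `t` pays for `P_E(e)`;
    -- distinct `b` use distinct preimages.
    have h4 : (∑ b, if S b e then marginalE P e else 0) ≤ marginalE P e / t := by
      calc (∑ b, if S b e then marginalE P e else 0)
          ≤ ∑ b, pushSum f (fun a => P a e / t) b := by
            refine Finset.sum_le_sum fun b _ => ?_
            have hnn : ∀ a ∈ (Finset.univ : Finset 𝒜), 0 ≤ if f a = b then P a e / t else 0 := by
              intro a _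
              split_ifs
              · exact div_nonneg (hP a e) ht.le
              · exact le_rfl
            split_ifs with h
            · obtain ⟨a, ha, hat⟩ := h
              refine (marginalE_le_div hP ht a e hat).trans ?_
              have := Finset.single_le_sum hnn (Finset.mem_univ a)
              simpa [ha, pushSum] using this
            · exact Finset.sum_nonneg hnn
        _ = marginalE P e / t := by rw [sum_pushSum, ← Finset.sum_div, marginalE]
    have h5 : 1 / M * (∑ b, if S b e then marginalE P e else 0) ≤ marginalE P e / (M * t) := by
      calc _ ≤ 1 / M * (marginalE P e / t) := by gcongr
        _ = _ := by field_simp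
    rw [h2] at h1
    linarith
  rw [hd]
  refine le_trans (le_of_eq ?_) (Finset.sum_le_sum fun e _ => hcol e)
  rw [← Finset.mul_sum, Finset.sum_sub_distrib, ← Finset.sum_div, sum_marginalE, hP1, largeMass,
    Finset.sum_comm]

/-- Triangle inequality, for weights of any total mass: it serves both the removed likely part and
the trivial bound `2`. -/
theorem d1'_le_two_mul_sum {P : 𝒜 → ℰ → ℝ} (hP : ∀ a e, 0 ≤ P a e) :
    d1' P ≤ 2 * ∑ a, ∑ e, P a e := by
  have hmE : ∀ e, 0 ≤ marginalE P e := fun e => Finset.sum_nonneg fun a _ => hP a e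
  calc d1' P ≤ ∑ a, ∑ e, (P a e + 1 / (Fintype.card 𝒜 : ℝ) * marginalE P e) := by
        refine Finset.sum_le_sum fun a _ => Finset.sum_le_sum fun e _ => ?_
        have h1 : 0 ≤ 1 / (Fintype.card 𝒜 : ℝ) * marginalE P e :=
          mul_nonneg (by positivity) (hmE e)
        have h2 := hP a e
        rw [abs_le]; constructor <;> linarith
    _ = (∑ a, ∑ e, P a e) + (Fintype.card 𝒜 / Fintype.card 𝒜 : ℝ) * ∑ a, ∑ e, P a e := by
        simp only [Finset.sum_add_distrib, ← Finset.mul_sum, sum_marginalE, Finset.sum_const,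
          Finset.card_univ, nsmul_eq_mul]
        ring
    _ ≤ _ := by
        -- An inequality only: for an empty alphabet the quotient is `0`.
        have h1 : (Fintype.card 𝒜 / Fintype.card 𝒜 : ℝ) ≤ 1 := div_self_le_one _
        have h2 : 0 ≤ ∑ a, ∑ e, P a e :=
          Finset.sum_nonneg fun a _ => Finset.sum_nonneg fun e _ => hP a e
        nlinarith

theorem d1'_add_le (P Q : 𝒜 → ℰ → ℝ) :
    d1' (fun a e => P a e + Q a e) ≤ d1' P + d1' Q := by
  simp only [d1', ← Finset.sum_add_distrib]
  refine Finset.sum_le_sum fun a _ => Finset.sum_le_sum fun e _ => ?_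
  refine le_trans (le_of_eq ?_) (abs_add_le _ _)
  simp only [marginalE, Finset.sum_add_distrib]
  congr 1; ring

theorem sum_keyDist (f : 𝒜 → ℬ) (P : 𝒜 → ℰ → ℝ) :
    ∑ b, ∑ e, keyDist f P b e = ∑ a, ∑ e, P a e := by
  rw [← sum_marginalE, ← sum_marginalE]
  simp only [marginalE_keyDist]

omit [Fintype ℬ] [Fintype ℰ] in
theorem keyDist_nonneg {P : 𝒜 → ℰ → ℝ} (hP : ∀ a e, 0 ≤ P a e) (f : 𝒜 → ℬ) (b : ℬ) (e : ℰ) :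
    0 ≤ keyDist f P b e := by
  refine Finset.sum_nonneg fun a _ => ?_
  split_ifs
  · exact hP a e
  · exact le_rfl

theorem d1'_keyDist_le_two {P : 𝒜 → ℰ → ℝ} (hP : ∀ a e, 0 ≤ P a e)
    (hP1 : ∑ a, ∑ e, P a e = 1) (f : 𝒜 → ℬ) : d1' (keyDist f P) ≤ 2 := by
  refine (d1'_le_two_mul_sum (keyDist_nonneg hP f)).trans ?_
  rw [sum_keyDist, hP1, mul_one]

/-- Truncating the large conditional probabilities costs at most twice their mass. -/
theorem d1'_keyDist_le_truncDist {P : 𝒜 → ℰ → ℝ} (hP : ∀ a e, 0 ≤ P a e) (t : ℝ) (f : 𝒜 → ℬ) :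
    d1' (keyDist f P) ≤ d1' (keyDist f (truncDist P t)) + 2 * largeMass P t := by
  classical
  set T : 𝒜 → ℰ → ℝ := fun a e => if t ≤ condProb P a e then P a e else 0 with hT
  have h1 : keyDist f P = fun b e => keyDist f (truncDist P t) b e + keyDist f T b e := by
    ext b e
    simp only [keyDist, ← Finset.sum_add_distrib]
    refine Finset.sum_congr rfl fun a _ => ?_
    simp only [hT, truncDist]
    split_ifs <;> simp
  have hT0 : ∀ a e, 0 ≤ T a e := by
    intro a e
    simp only [hT]
    split_ifs
    · exact hP a e
    · exact le_rfl
  rw [h1]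
  refine (d1'_add_le _ _).trans ?_
  have h2 := d1'_le_two_mul_sum (keyDist_nonneg hT0 f)
  rw [sum_keyDist] at h2
  have h3 : ∑ a, ∑ e, T a e = largeMass P t := rfl
  linarith

/-- Comparison of the `L₁` distance with a weighted `L₂` distance. -/
theorem d1'_keyDist_sq_le {w : ℰ → ℝ} (hw : ∀ e, 0 ≤ w e) (hw1 : ∑ e, w e = 1)
    {Q : 𝒜 → ℰ → ℝ} (hQ : ∀ a e, w e = 0 → Q a e = 0) (f : 𝒜 → ℬ) :
    d1' (keyDist f Q) ^ 2 ≤ ∑ e, (w e)⁻¹ * (Fintype.card ℬ * ∑ b,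
      (pushSum f (fun a => Q a e) b - (∑ a, Q a e) / Fintype.card ℬ) ^ 2) := by
  classical
  rcases isEmpty_or_nonempty ℬ with hB | hB
  · simp [d1']
  have hM : (0 : ℝ) < Fintype.card ℬ := by exact_mod_cast Fintype.card_pos
  set M : ℝ := (Fintype.card ℬ : ℝ) with hMdef
  set D : ℬ → ℰ → ℝ := fun b e => pushSum f (fun a => Q a e) b - (∑ a, Q a e) / M with hD
  have hD0 : ∀ b e, w e = 0 → D b e = 0 := by
    intro b e h
    simp [hD, pushSum, hQ _ e h]
  have hd : d1' (keyDist f Q) = ∑ x : ℰ × ℬ, |D x.2 x.1| := by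
    rw [d1', Finset.sum_comm, Fintype.sum_prod_type]
    refine Finset.sum_congr rfl fun e _ => Finset.sum_congr rfl fun b _ => ?_
    rw [marginalE_keyDist, keyDist_eq_pushSum, marginalE]
    simp only [hD, hMdef]
    congr 1; ring
  rw [hd]
  -- Cauchy–Schwarz against the probability weights `w e / M`. Where `w e = 0` the convention `0⁻¹ =
  -- 0` is harmless, because `D` vanishes there.
  have hcs := Finset.sum_sq_le_sum_mul_sum_of_sq_le_mul (Finset.univ : Finset (ℰ × ℬ))
    (r := fun x => |D x.2 x.1|) (f := fun x => w x.1 / M)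
    (g := fun x => (w x.1)⁻¹ * (M * D x.2 x.1 ^ 2))
    (fun x _ => div_nonneg (hw _) hM.le)
    (fun x _ => mul_nonneg (inv_nonneg.2 (hw _)) (by positivity)) (by
      intro x _
      refine le_of_eq ?_
      rw [sq_abs]
      by_cases h : w x.1 = 0
      · simp [hD0 _ _ h]
      · field_simp)
  refine hcs.trans (le_of_eq ?_)
  have h1 : ∑ x : ℰ × ℬ, w x.1 / M = 1 := by
    rw [Fintype.sum_prod_type]
    simp only [Finset.sum_const, Finset.card_univ, nsmul_eq_mul, ← hMdef]
    rw [← hw1]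
    refine Finset.sum_congr rfl fun e _ => ?_
    field_simp
  rw [h1, one_mul, Fintype.sum_prod_type]
  refine Finset.sum_congr rfl fun e _ => ?_
  simp only [Finset.mul_sum, hD]

/-- The weighted family `(p, f)` of functions has mean square deviation at most `ε`:
the images of a weight `g` deviate from the uniform weight by at most `ε ‖g‖₂²` in mean square. -/
def HasMeanSquareBound {Φ : Type*} [Fintype Φ] (p : Φ → ℝ) (f : Φ → 𝒜 → ℬ) (ε : ℝ) : Prop :=
  ∀ g : 𝒜 → ℝ, ∑ φ, p φ * (Fintype.card ℬ * ∑ b,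
    (pushSum (f φ) g b - (∑ a, g a) / Fintype.card ℬ) ^ 2) ≤ ε * Fintype.card ℬ * ∑ a, g a ^ 2

/-- Leftover hash lemma. -/
theorem sum_mul_d1'_truncDist_le {Φ : Type*} [Fintype Φ] {p : Φ → ℝ} {f : Φ → 𝒜 → ℬ} {ε : ℝ}
    (hp : ∀ φ, 0 ≤ p φ) (hp1 : ∑ φ, p φ ≤ 1) (hε : 0 ≤ ε) (h : HasMeanSquareBound p f ε)
    {P : 𝒜 → ℰ → ℝ} (hP : ∀ a e, 0 ≤ P a e) (hP1 : ∑ a, ∑ e, P a e = 1) {t : ℝ} (ht : 0 < t) :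
    ∑ φ, p φ * d1' (keyDist (f φ) (truncDist P t)) ≤ Real.sqrt (ε * (Fintype.card ℬ * t)) := by
  classical
  set M : ℝ := (Fintype.card ℬ : ℝ) with hMdef
  have hM : 0 ≤ M := by positivity
  set w := marginalE P with hwdef
  have hw : ∀ e, 0 ≤ w e := fun e => Finset.sum_nonneg fun a _ => hP a e
  have hw1 : ∑ e, w e = 1 := by rw [hwdef, sum_marginalE, hP1]
  have hPw : ∀ a e, w e = 0 → P a e = 0 := by
    intro a e he
    exact (Finset.sum_eq_zero_iff_of_nonneg (fun a _ => hP a e)).1 he a (Finset.mem_univ a)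
  have hQw : ∀ a e, w e = 0 → truncDist P t a e = 0 := by
    intro a e he
    simp [truncDist, hPw a e he]
  refine Real.le_sqrt_of_sq_le ?_
  calc (∑ φ, p φ * d1' (keyDist (f φ) (truncDist P t))) ^ 2
      ≤ (∑ φ, p φ) * ∑ φ, p φ * d1' (keyDist (f φ) (truncDist P t)) ^ 2 :=
        Finset.sum_sq_le_sum_mul_sum_of_sq_le_mul _ (fun φ _ => hp φ)
          (fun φ _ => mul_nonneg (hp φ) (sq_nonneg _)) (fun φ _ => le_of_eq (by ring))
    _ ≤ 1 * ∑ φ, p φ * d1' (keyDist (f φ) (truncDist P t)) ^ 2 := by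
        gcongr
        exact Finset.sum_nonneg fun φ _ => mul_nonneg (hp φ) (sq_nonneg _)
    _ ≤ ∑ φ, p φ * ∑ e, (w e)⁻¹ * (M * ∑ b,
      (pushSum (f φ) (fun a => truncDist P t a e) b - (∑ a, truncDist P t a e) / M) ^ 2) := by
        rw [one_mul]
        refine Finset.sum_le_sum fun φ _ => mul_le_mul_of_nonneg_left ?_ (hp φ)
        exact d1'_keyDist_sq_le hw hw1 hQw (f φ)
    _ = ∑ e, (w e)⁻¹ * ∑ φ, p φ * (M * ∑ b,
      (pushSum (f φ) (fun a => truncDist P t a e) b - (∑ a, truncDist P t a e) / M) ^ 2) := by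
        simp only [Finset.mul_sum (Finset.univ : Finset ℰ)]
        rw [Finset.sum_comm]
        refine Finset.sum_congr rfl fun e _ => ?_
        rw [Finset.mul_sum]
        exact Finset.sum_congr rfl fun φ _ => by ring
    _ ≤ ∑ e, (w e)⁻¹ * (ε * M * ∑ a, truncDist P t a e ^ 2) := by
        refine Finset.sum_le_sum fun e _ => mul_le_mul_of_nonneg_left (h _) ?_
        exact inv_nonneg.2 (hw e)
    -- After truncation `Q(a, e) ≤ t w(e)`, hence `Q² ≤ t w(e) P(a, e)`; the factor `w(e)⁻¹` cancels
    -- and the sum over `a` leaves `t w(e)`.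
    _ ≤ ∑ e, ε * M * (t * w e) := by
        refine Finset.sum_le_sum fun e _ => ?_
        rw [mul_left_comm]
        refine mul_le_mul_of_nonneg_left ?_ (mul_nonneg hε hM)
        rw [hwdef, marginalE, Finset.mul_sum, Finset.mul_sum]
        refine Finset.sum_le_sum fun a _ => ?_
        change (w e)⁻¹ * _ ≤ _
        simp only [truncDist]
        split_ifs with hc
        · simpa using mul_nonneg ht.le (hP a e)
        · rcases (hw e).eq_or_lt with h0 | h0
          · simp [hPw a e h0.symm]
          · rw [condProb, not_le, div_lt_iff₀ h0] at hc
            rw [inv_mul_le_iff₀ h0]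
            nlinarith [hP a e]
    _ = ε * (M * t) := by
        rw [← Finset.mul_sum, ← Finset.mul_sum, hw1]; ring

end OneShot

/-! ### Second moment of a uniformly random function -/

section UniformFunction

variable {𝒜 ℬ : Type*} [Fintype 𝒜] [Fintype ℬ]

/-- The values at two distinct points are independent under the uniform law: with the rest of `f`
fixed, summing over `f a` alone already gives zero. -/
theorem sum_pi_mul_eq_zero [DecidableEq 𝒜] {c : ℬ → ℝ} (hc : ∑ b, c b = 0) {a a' : 𝒜}
    (h : a ≠ a') : ∑ f : 𝒜 → ℬ, c (f a) * c (f a') = 0 := by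
  classical
  rw [← (Equiv.funSplitAt a ℬ).symm.sum_comp, Fintype.sum_prod_type, Finset.sum_comm]
  refine Finset.sum_eq_zero fun r _ => ?_
  have : ∀ b, c ((Equiv.funSplitAt a ℬ).symm (b, r) a) * c ((Equiv.funSplitAt a ℬ).symm (b, r) a')
      = c b * c (r ⟨a', h.symm⟩) := by
    intro b
    simp [Equiv.funSplitAt, Equiv.piSplitAt, h.symm]
  simp only [this, ← Finset.sum_mul, hc, zero_mul]

/-- The uniformly distributed function satisfies the mean square bound with `ε = 1`. -/
theorem hasMeanSquareBound_uniform [DecidableEq 𝒜] [Nonempty ℬ] :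
    HasMeanSquareBound (fun _ : 𝒜 → ℬ => (Fintype.card (𝒜 → ℬ) : ℝ)⁻¹) (fun f => f) 1 := by
  classical
  intro g
  have hM : (0 : ℝ) < Fintype.card ℬ := by exact_mod_cast Fintype.card_pos
  have hN : (0 : ℝ) < Fintype.card (𝒜 → ℬ) := by exact_mod_cast Fintype.card_pos
  set M : ℝ := (Fintype.card ℬ : ℝ) with hMdef
  set N : ℝ := (Fintype.card (𝒜 → ℬ) : ℝ) with hNdef
  -- The centred indicator of `b`: the deviation from uniformity is linear in it, and its square
  -- summed over `b` is `1 - 1/M`.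
  set c : ℬ → ℬ → ℝ := fun b x => (if x = b then 1 else 0) - 1 / M with hcdef
  have hc : ∀ b, ∑ x, c b x = 0 := by
    intro b
    simp only [hcdef, Finset.sum_sub_distrib, Finset.sum_ite_eq', Finset.mem_univ, if_true,
      Finset.sum_const, Finset.card_univ, nsmul_eq_mul, ← hMdef]
    field_simp
    ring
  have hc2 : ∀ x, ∑ b, c b x ^ 2 ≤ 1 := by
    intro x
    have : ∀ b, c b x ^ 2 = (if x = b then 1 - 2 / M else 0) + 1 / M ^ 2 := by
      intro b
      simp only [hcdef]
      split_ifs <;> ring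
    simp only [this, Finset.sum_add_distrib, Finset.sum_ite_eq, Finset.mem_univ, if_true,
      Finset.sum_const, Finset.card_univ, nsmul_eq_mul, ← hMdef]
    have : M * (1 / M ^ 2) = 1 / M := by field_simp
    have h2 : 0 < 1 / M := by positivity
    rw [this, show 2 / M = 2 * (1 / M) by ring]
    linarith
  have hdev : ∀ (f : 𝒜 → ℬ) b, pushSum f g b - (∑ a, g a) / M = ∑ a, g a * c b (f a) := by
    intro f b
    simp only [pushSum, hcdef, mul_sub, Finset.sum_sub_distrib, ← Finset.sum_mul]
    simp [div_eq_mul_inv]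
  have key : ∀ b, ∑ f : 𝒜 → ℬ, (∑ a, g a * c b (f a)) ^ 2
      = ∑ f : 𝒜 → ℬ, ∑ a, g a ^ 2 * c b (f a) ^ 2 := by
    intro b
    have h1 : ∀ f : 𝒜 → ℬ, (∑ a, g a * c b (f a)) ^ 2
        = ∑ a, ∑ a', g a * g a' * (c b (f a) * c b (f a')) := by
      intro f
      rw [sq, Finset.sum_mul_sum]
      exact Finset.sum_congr rfl fun a _ => Finset.sum_congr rfl fun a' _ => by ring
    simp only [h1]
    rw [Finset.sum_comm, Finset.sum_comm (γ := 𝒜 → ℬ)]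
    refine Finset.sum_congr rfl fun a _ => ?_
    rw [Finset.sum_comm, Finset.sum_eq_single a]
    · exact Finset.sum_congr rfl fun f _ => by ring
    · intro a' _ ha'
      rw [← Finset.mul_sum, sum_pi_mul_eq_zero (hc b) ha'.symm, mul_zero]
    · simp
  calc ∑ f : 𝒜 → ℬ, N⁻¹ * (M * ∑ b, (pushSum f g b - (∑ a, g a) / M) ^ 2)
      = N⁻¹ * (M * ∑ b, ∑ f : 𝒜 → ℬ, (∑ a, g a * c b (f a)) ^ 2) := by
        rw [← Finset.mul_sum, ← Finset.mul_sum, Finset.sum_comm]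
        simp only [hdev]
    _ = N⁻¹ * (M * ∑ f : 𝒜 → ℬ, ∑ a, g a ^ 2 * ∑ b, c b (f a) ^ 2) := by
        simp only [key]
        rw [Finset.sum_comm]
        congr 2
        refine Finset.sum_congr rfl fun f _ => ?_
        rw [Finset.sum_comm]
        simp only [Finset.mul_sum]
    _ ≤ N⁻¹ * (M * ∑ f : 𝒜 → ℬ, ∑ a, g a ^ 2 * 1) := by
        gcongr with f _ a _
        exact hc2 _
    _ = 1 * M * ∑ a, g a ^ 2 := by
        simp only [mul_one, Finset.sum_const, Finset.card_univ, nsmul_eq_mul, ← hNdef]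
        field_simp

end UniformFunction

/-! ### Fourier analysis with an additive character of the field -/

section Parseval

variable {F V W : Type*} [Field F] [AddCommGroup V] [Module F V] [AddCommGroup W] [Module F W]
  [Fintype W]

/-- The map `w ↦ ψ (B w u)` is a nontrivial additive character of `W`, and such characters sum to
zero. -/
theorem sum_addChar_bilin {ψ : AddChar F ℂ} (hψ : ψ ≠ 0) (B : W →ₗ[F] V →ₗ[F] F) {u : V}
    (hu : ∃ w, B w u ≠ 0) : ∑ w, ψ (B w u) = 0 := by
  obtain ⟨w, hw⟩ := hu
  obtain ⟨x, hx⟩ := AddChar.ne_one_iff.1 hψ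
  have h : ψ.compAddMonoidHom (B.flip u).toAddMonoidHom ≠ 0 := by
    -- Rescaling `w` makes the form take the value `x`, where `ψ` is nontrivial.
    refine AddChar.ne_one_iff.2 ⟨(x / B w u) • w, ?_⟩
    simpa [hw] using hx
  simpa using AddChar.sum_eq_zero_iff_ne_zero.2 h

/-- Parseval's identity for the Fourier transform along a nondegenerate bilinear form. -/
theorem sum_norm_sq_addChar_bilin [Finite F] [Fintype V] {ψ : AddChar F ℂ} (hψ : ψ ≠ 0)
    (B : W →ₗ[F] V →ₗ[F] F) (hB : ∀ u, u ≠ 0 → ∃ w, B w u ≠ 0) (g : V → ℝ) :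
    ∑ w, ‖∑ v, (g v : ℂ) * ψ (B w v)‖ ^ 2 = Fintype.card W * ∑ v, g v ^ 2 := by
  classical
  have h1 : ∀ w, ((‖∑ v, (g v : ℂ) * ψ (B w v)‖ ^ 2 : ℝ) : ℂ)
      = ∑ v, ∑ v', (g v : ℂ) * g v' * ψ (B w (v - v')) := by
    intro w
    rw [← Complex.normSq_eq_norm_sq, ← Complex.mul_conj, map_sum, Finset.sum_mul_sum]
    refine Finset.sum_congr rfl fun v _ => Finset.sum_congr rfl fun v' _ => ?_
    rw [map_mul, Complex.conj_ofReal, ← AddChar.map_neg_eq_conj, map_sub, sub_eq_add_neg,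
      AddChar.map_add_eq_mul]
    ring
  have h2 : ((∑ w, ‖∑ v, (g v : ℂ) * ψ (B w v)‖ ^ 2 : ℝ) : ℂ)
      = ((Fintype.card W * ∑ v, g v ^ 2 : ℝ) : ℂ) := by
    rw [Complex.ofReal_sum]
    simp only [h1]
    rw [Finset.sum_comm]
    push_cast
    rw [Finset.mul_sum]
    refine Finset.sum_congr rfl fun v _ => ?_
    rw [Finset.sum_comm, Finset.sum_eq_single v]
    · simp [sq, mul_comm]
    · intro v' _ hv'
      rw [← Finset.mul_sum, sum_addChar_bilin hψ B (hB _ (sub_ne_zero.2 hv'.symm)), mul_zero]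
    · simp
  exact_mod_cast h2

end Parseval

/-! ### Linear hash functions and the dual code of the kernel -/

section LinearHash

variable {F : Type*} [Field F] {n k m : ℕ}

/-- The standard bilinear form on `F^m`. -/
def stdForm (F : Type*) [Field F] (m : ℕ) : (Fin m → F) →ₗ[F] (Fin m → F) →ₗ[F] F :=
  LinearMap.mk₂ F (fun y b => ∑ i, y i * b i)
    (fun _ _ _ => by simp [add_mul, Finset.sum_add_distrib])
    (fun _ _ _ => by simp [mul_assoc, Finset.mul_sum])
    (fun _ _ _ => by simp [mul_add, Finset.sum_add_distrib])
    (fun _ _ _ => by simp [mul_left_comm, Finset.mul_sum])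

/-- The standard bilinear form on `F^(nk)`. -/
def stdForm₂ (F : Type*) [Field F] (n k : ℕ) :
    (Fin n → Fin k → F) →ₗ[F] (Fin n → Fin k → F) →ₗ[F] F :=
  LinearMap.mk₂ F (fun x a => ∑ i, ∑ j, a i j * x i j)
    (fun _ _ _ => by simp [mul_add, Finset.sum_add_distrib])
    (fun _ _ _ => by simp [mul_left_comm, Finset.mul_sum])
    (fun _ _ _ => by simp [add_mul, Finset.sum_add_distrib])
    (fun _ _ _ => by simp [mul_assoc, Finset.mul_sum])

theorem stdForm_nondegenerate (u : Fin m → F) (hu : u ≠ 0) : ∃ w, stdForm F m w u ≠ 0 := by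
  obtain ⟨i, hi⟩ := Function.ne_iff.1 hu
  exact ⟨Pi.single i 1, by simpa [stdForm, Pi.single_apply] using hi⟩

theorem stdForm₂_nondegenerate (u : Fin n → Fin k → F) (hu : u ≠ 0) :
    ∃ w, stdForm₂ F n k w u ≠ 0 := by
  obtain ⟨i, hi⟩ := Function.ne_iff.1 hu
  obtain ⟨j, hj⟩ := Function.ne_iff.1 hi
  refine ⟨Pi.single i (Pi.single j 1), ?_⟩
  have : stdForm₂ F n k (Pi.single i (Pi.single j 1)) u = u i j := by
    simp only [stdForm₂, LinearMap.mk₂_apply]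
    rw [Finset.sum_eq_single i, Finset.sum_eq_single j]
    · simp
    · intro j' _ h
      simp [h]
    · simp
    · intro i' _ h
      simp [h]
    · simp
  rw [this]
  exact hj

theorem exists_stdForm₂_eq (L : (Fin n → Fin k → F) →ₗ[F] F) : ∃ x, stdForm₂ F n k x = L := by
  refine ⟨fun i j => L (Pi.single i (Pi.single j 1)), ?_⟩
  refine LinearMap.pi_ext' fun i => LinearMap.pi_ext' fun j => LinearMap.ext_ring ?_
  simp only [stdForm₂, LinearMap.coe_comp, Function.comp_apply, LinearMap.mk₂_apply,
    LinearMap.single_apply]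
  rw [Finset.sum_eq_single i, Finset.sum_eq_single j]
  · simp
  · intro j' _ h
    simp [h]
  · simp
  · intro i' _ h
    simp [h]
  · simp

/-- The transpose of `φ`, obtained by representing each functional `a ↦ y · φ a`. Only the adjoint
relation is used, so `τ` is left a bare function. -/
theorem exists_adjoint (φ : (Fin n → Fin k → F) →ₗ[F] (Fin m → F)) :
    ∃ τ : (Fin m → F) → (Fin n → Fin k → F),
      ∀ y a, stdForm₂ F n k (τ y) a = stdForm F m y (φ a) := by
  choose τ hτ using fun y => exists_stdForm₂_eq ((stdForm F m y).comp φ)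
  exact ⟨τ, fun y a => by rw [hτ]; rfl⟩

variable [Fintype F]

theorem exists_addChar_ne_zero (F : Type*) [Field F] [Finite F] : ∃ ψ : AddChar F ℂ, ψ ≠ 0 := by
  refine ⟨AddChar.FiniteField.primitiveChar_to_Complex F, fun h => ?_⟩
  have := AddChar.FiniteField.primitiveChar_to_Complex_isPrimitive F (one_ne_zero)
  rw [h] at this
  exact this (by ext; simp)

/-- For a surjective linear function, the deviation from uniformity is bounded by the Fourier
coefficients on the dual code of its kernel. -/
theorem card_mul_sum_pushSum_sub_sq_le {ψ : AddChar F ℂ} (hψ : ψ ≠ 0)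
    {φ : (Fin n → Fin k → F) →ₗ[F] (Fin m → F)} (hφ : Function.Surjective φ)
    (g : (Fin n → Fin k → F) → ℝ) :
    (Fintype.card (Fin m → F) : ℝ) * ∑ b,
      (pushSum φ g b - (∑ a, g a) / (Fintype.card (Fin m → F) : ℝ)) ^ 2 ≤
    ∑ x, open Classical in if x ≠ 0 ∧ x ∈ dualCode (LinearMap.ker φ) then
      ‖∑ a, (g a : ℂ) * ψ (stdForm₂ F n k x a)‖ ^ 2 else 0 := by
  classical
  obtain ⟨τ, hτ⟩ := exists_adjoint φ
  set M : ℝ := (Fintype.card (Fin m → F) : ℝ) with hMdef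
  have hM : M ≠ 0 := by
    have : (0 : ℝ) < M := by rw [hMdef]; exact_mod_cast Fintype.card_pos
    exact this.ne'
  have hτ0 : ∀ y, τ y = 0 → y = 0 := by
    intro y hy
    by_contra h
    obtain ⟨b, hb⟩ := stdForm_nondegenerate y h
    obtain ⟨a, rfl⟩ := hφ b
    have h1 := hτ y a
    rw [hy, map_zero, LinearMap.zero_apply] at h1
    apply hb
    rw [h1]
    simp only [stdForm, LinearMap.mk₂_apply]
    exact Finset.sum_congr rfl fun i _ => mul_comm _ _
  -- Surjectivity of `φ` enters here: a vector orthogonal to the whole range must vanish, so no dual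
  -- codeword is counted twice.
  have hinj : Function.Injective τ := by
    intro y y' h
    by_contra hne
    obtain ⟨b, hb⟩ := stdForm_nondegenerate (y - y') (sub_ne_zero.2 hne)
    obtain ⟨a, rfl⟩ := hφ b
    apply hb
    have : stdForm F m (φ a) (y - y') = stdForm F m (y - y') (φ a) := by
      simp only [stdForm, LinearMap.mk₂_apply]
      exact Finset.sum_congr rfl fun i _ => mul_comm _ _
    rw [this, map_sub, LinearMap.sub_apply, ← hτ, ← hτ, h, sub_self]
  -- The order of factors in `stdForm₂` is that of `dualCode`, so membership is the adjoint relation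
  -- verbatim.
  have hdual : ∀ y, τ y ∈ dualCode (LinearMap.ker φ) := by
    intro y a ha
    have := hτ y a
    rw [LinearMap.mem_ker.1 ha, map_zero] at this
    exact this
  rw [← sum_norm_sq_addChar_bilin hψ (stdForm F m) stdForm_nondegenerate]
  -- Subtracting the mean kills the coefficient at `y = 0` and leaves the others unchanged; those
  -- are the coefficients of `g` at `τ y`.
  have hcoef : ∀ y, ‖∑ b, ((pushSum φ g b - (∑ a, g a) / M : ℝ) : ℂ) * ψ (stdForm F m y b)‖ ^ 2
      = if y = 0 then 0 else ‖∑ a, (g a : ℂ) * ψ (stdForm₂ F n k (τ y) a)‖ ^ 2 := by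
    intro y
    split_ifs with hy
    · subst hy
      have : ∑ b, (pushSum φ g b - (∑ a, g a) / M) = 0 := by
        rw [Finset.sum_sub_distrib, sum_pushSum, Finset.sum_const, Finset.card_univ, nsmul_eq_mul,
          ← hMdef]
        field_simp
        ring
      simp only [map_zero, LinearMap.zero_apply, AddChar.map_zero_eq_one, mul_one]
      rw [← Complex.ofReal_sum, this]
      simp
    · have h0 : ∑ b, ψ (stdForm F m y b) = 0 := by
        have := sum_addChar_bilin hψ (stdForm F m).flip (u := y) (by
          obtain ⟨w, hw⟩ := stdForm_nondegenerate y hy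
          refine ⟨w, ?_⟩
          rw [LinearMap.flip_apply]
          convert hw using 1
          simp only [stdForm, LinearMap.mk₂_apply]
          exact Finset.sum_congr rfl fun i _ => mul_comm _ _)
        simpa using this
      have h1 : ∑ b, ((pushSum φ g b - (∑ a, g a) / M : ℝ) : ℂ) * ψ (stdForm F m y b)
          = ∑ b, (pushSum φ g b : ℂ) * ψ (stdForm F m y b) := by
        simp only [Complex.ofReal_sub, sub_mul, Finset.sum_sub_distrib, ← Finset.mul_sum, h0,
          mul_zero, sub_zero]
      have h2 : ∑ b, (pushSum φ g b : ℂ) * ψ (stdForm F m y b)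
          = ∑ a, (g a : ℂ) * ψ (stdForm F m y (φ a)) := by
        simp only [pushSum, Complex.ofReal_sum, Finset.sum_mul]
        rw [Finset.sum_comm]
        refine Finset.sum_congr rfl fun a _ => ?_
        rw [Finset.sum_eq_single (φ a)]
        · simp
        · intro b _ hb
          simp [hb.symm]
        · simp
      rw [h1, h2]
      simp only [hτ]
  simp only [hcoef]
  calc _ = ∑ y, (fun x => if x ≠ 0 ∧ x ∈ dualCode (LinearMap.ker φ) then
      ‖∑ a, (g a : ℂ) * ψ (stdForm₂ F n k x a)‖ ^ 2 else 0) (τ y) := by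
        refine Finset.sum_congr rfl fun y _ => ?_
        by_cases hy : y = 0
        · subst hy
          have : τ 0 = 0 := by
            by_contra h
            obtain ⟨w, hw⟩ := stdForm₂_nondegenerate _ h
            apply hw
            have h3 := hτ 0 w
            simp only [map_zero, LinearMap.zero_apply] at h3
            rw [← h3]
            simp only [stdForm₂, LinearMap.mk₂_apply]
            exact Finset.sum_congr rfl fun i _ => Finset.sum_congr rfl fun j _ => mul_comm _ _
          simp [this]
        · have : τ y ≠ 0 := fun h => hy (hτ0 y h)
          simp [hy, this, hdual]
    _ ≤ _ := by
        rw [← Finset.sum_image (f := fun x => if x ≠ 0 ∧ x ∈ dualCode (LinearMap.ker φ) then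
          ‖∑ a, (g a : ℂ) * ψ (stdForm₂ F n k x a)‖ ^ 2 else 0) (fun y _ y' _ h => hinj h)]
        refine Finset.sum_le_sum_of_subset_of_nonneg (Finset.subset_univ _) fun x _ _ => ?_
        split_ifs
        · positivity
        · exact le_rfl

/-- Surjective linear functions whose kernels are dual universal satisfy the mean square bound. -/
theorem hasMeanSquareBound_of_dual {Φ : Type*} [Fintype Φ]
    {f : Φ → (Fin n → Fin k → F) →ₗ[F] (Fin m → F)} {p : Φ → ℝ} (hp : ∀ φ, 0 ≤ p φ)
    (hsurj : ∀ φ, p φ ≠ 0 → Function.Surjective (f φ)) {ε : ℝ} (hε : 0 ≤ ε)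
    (hdual : ∀ x : Fin n → Fin k → F, x ≠ 0 →
      (∑ φ, open Classical in if x ∈ dualCode (LinearMap.ker (f φ)) then p φ else 0) *
        Fintype.card (Fin n → Fin k → F) ≤ ε * Fintype.card (Fin m → F)) :
    HasMeanSquareBound p (fun φ => ⇑(f φ)) ε := by
  classical
  intro g
  obtain ⟨ψ, hψ⟩ := exists_addChar_ne_zero F
  have hN : (0 : ℝ) < Fintype.card (Fin n → Fin k → F) := by exact_mod_cast Fintype.card_pos
  set c : (Fin n → Fin k → F) → ℝ := fun x => ‖∑ a, (g a : ℂ) * ψ (stdForm₂ F n k x a)‖ ^ 2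
    with hc
  have hc0 : ∀ x, 0 ≤ c x := fun x => by positivity
  have hpars : ∑ x, c x = Fintype.card (Fin n → Fin k → F) * ∑ a, g a ^ 2 :=
    sum_norm_sq_addChar_bilin hψ (stdForm₂ F n k) stdForm₂_nondegenerate g
  calc _ ≤ ∑ φ, p φ * ∑ x, if x ≠ 0 ∧ x ∈ dualCode (LinearMap.ker (f φ)) then c x else 0 := by
        refine Finset.sum_le_sum fun φ _ => ?_
        by_cases h : p φ = 0
        · simp [h]
        · exact mul_le_mul_of_nonneg_left
            (card_mul_sum_pushSum_sub_sq_le hψ (hsurj φ h) g) (hp φ)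
    _ = ∑ x, if x ≠ 0 then
        c x * ∑ φ, if x ∈ dualCode (LinearMap.ker (f φ)) then p φ else 0 else 0 := by
        simp only [Finset.mul_sum]
        rw [Finset.sum_comm]
        refine Finset.sum_congr rfl fun x _ => ?_
        by_cases hx : x = 0
        · simp [hx]
        · simp only [ne_eq, hx, not_false_eq_true, true_and, if_true]
          refine Finset.sum_congr rfl fun φ _ => ?_
          split_ifs <;> ring
    _ ≤ ∑ x, c x * (ε * Fintype.card (Fin m → F) / Fintype.card (Fin n → Fin k → F)) := by
        refine Finset.sum_le_sum fun x _ => ?_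
        split_ifs with hx
        · refine mul_le_mul_of_nonneg_left ?_ (hc0 x)
          rw [le_div_iff₀ hN]
          exact hdual x hx
        · exact mul_nonneg (hc0 x) (by positivity)
    _ = _ := by
        rw [← Finset.sum_mul, hpars]
        field_simp

end LinearHash

/-! ### Central limit theorem with a moving threshold -/

section CentralLimit

open ProbabilityTheory

/-- By Slutsky, `Z n - c n` converges in distribution to `Y - c₀`; the portmanteau theorem then
applies to the fixed half-line `Iic 0`, whose frontier is null. -/
theorem tendsto_measureReal_le_of_tendstoInDistribution {Ω Ω' : Type*} [MeasurableSpace Ω]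
    [MeasurableSpace Ω'] {μ : Measure Ω} [IsProbabilityMeasure μ] {ν : Measure Ω'}
    [IsProbabilityMeasure ν] {Z : ℕ → Ω → ℝ} {Y : Ω' → ℝ}
    (h : TendstoInDistribution Z atTop Y (fun _ => μ) ν) {c : ℕ → ℝ} {c₀ : ℝ}
    (hc : Tendsto c atTop (𝓝 c₀)) (h0 : ν.map Y {c₀} = 0) :
    Tendsto (fun n => μ.real {ω | Z n ω ≤ c n}) atTop (𝓝 ((ν.map Y).real (Set.Iic c₀))) := by
  have hconst : TendstoInMeasure μ (fun n (_ : Ω) => -c n) atTop (fun _ => -c₀) :=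
    tendstoInMeasure_of_tendsto_ae (fun n => aestronglyMeasurable_const)
      (ae_of_all _ fun _ => hc.neg)
  have h1 := h.add_of_tendstoInMeasure_const hconst fun _ => aemeasurable_const
  have hY : AEMeasurable Y ν := h.aemeasurable_limit
  have hmap : ∀ S : Set ℝ, MeasurableSet S →
      (ν.map fun ω => Y ω + -c₀) S = (ν.map Y) ((fun y => y + -c₀) ⁻¹' S) := by
    intro S hS
    rw [Measure.map_apply_of_aemeasurable (hY.add_const _) hS,
      Measure.map_apply_of_aemeasurable hY (measurable_add_const (-c₀) hS)]
    rfl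
  have h2 := ProbabilityMeasure.tendsto_measure_of_null_frontier_of_tendsto' h1.tendsto
    (E := Set.Iic 0) (by
      rw [frontier_Iic]
      change (ν.map fun ω => Y ω + -c₀) {0} = 0
      rw [hmap _ (measurableSet_singleton 0), ← h0]
      congr 1
      ext y
      simp [← sub_eq_add_neg, sub_eq_zero])
  have : IsProbabilityMeasure (ν.map fun ω => Y ω + -c₀) :=
    Measure.isProbabilityMeasure_map (hY.add_const _)
  have h3 := (ENNReal.tendsto_toReal
    (measure_ne_top (ν.map fun ω => Y ω + -c₀) (Set.Iic 0))).comp h2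
  convert h3 using 1
  · ext n
    simp only [Function.comp_apply, measureReal_def, ProbabilityMeasure.coe_mk]
    rw [Measure.map_apply_of_aemeasurable (h1.forall_aemeasurable n) measurableSet_Iic]
    congr 2
    ext ω
    simp [← sub_eq_add_neg]
  · congr 1
    simp only [measureReal_def]
    rw [hmap _ measurableSet_Iic]
    congr 2
    ext y
    simp [← sub_eq_add_neg]

theorem gaussianReal_real_Iic (c : ℝ) : (gaussianReal 0 1).real (Set.Iic c)
    = ∫ x in Set.Iic c, 1 / Real.sqrt (2 * Real.pi) * Real.exp (-x ^ 2 / 2) := by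
  rw [measureReal_def, gaussianReal_apply_eq_integral _ one_ne_zero, ENNReal.toReal_ofReal]
  · simp [gaussianPDFReal_def]
  · exact integral_nonneg fun x => gaussianPDFReal_nonneg _ _ _

/-- The central limit theorem for a random variable on a finite probability space. -/
theorem tendsto_sum_prod_clt {α : Type*} [Fintype α] {p X : α → ℝ} (hp : ∀ a, 0 ≤ p a)
    (hp1 : ∑ a, p a = 1) (h0 : ∑ a, p a * X a = 0) (h1 : ∑ a, p a * X a ^ 2 = 1)
    {c : ℕ → ℝ} {c₀ : ℝ} (hc : Tendsto c atTop (𝓝 c₀)) :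
    Tendsto (fun n : ℕ => ∑ z : Fin n → α, open Classical in
      if (Real.sqrt n)⁻¹ * ∑ i, X (z i) ≤ c n then ∏ i, p (z i) else 0) atTop
      (𝓝 (∫ x in Set.Iic c₀, 1 / Real.sqrt (2 * Real.pi) * Real.exp (-x ^ 2 / 2))) := by
  classical
  let _ : MeasurableSpace α := ⊤
  have : MeasurableSingletonClass α := ⟨fun _ => trivial⟩
  set q : PMF α := PMF.ofFintype (fun a => ENNReal.ofReal (p a)) (by
    rw [← ENNReal.ofReal_sum_of_nonneg fun a _ => hp a, hp1, ENNReal.ofReal_one]) with hq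
  set ν : Measure α := q.toMeasure with hν
  have hint : ∀ g : α → ℝ, ∫ a, g a ∂ν = ∑ a, p a * g a := by
    intro g
    rw [hν, PMF.integral_eq_sum]
    refine Finset.sum_congr rfl fun a _ => ?_
    rw [hq, PMF.ofFintype_apply, ENNReal.toReal_ofReal (hp a), smul_eq_mul]
  -- The limit theorem needs one probability space for all `n`; projecting to the first `n`
  -- coordinates recovers the finite product weights.
  set μ : Measure (ℕ → α) := Measure.infinitePi fun _ => ν with hμ
  have hXm : Measurable X := measurable_from_top
  have hind : iIndepFun (fun (i : ℕ) (ω : ℕ → α) => X (ω i)) μ :=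
    iIndepFun_infinitePi (P := fun _ : ℕ => ν) (X := fun _ => X) (fun _ => hXm)
  have hmap : ∀ i : ℕ, μ.map (fun ω => ω i) = ν := fun i =>
    (measurePreserving_eval_infinitePi (fun _ : ℕ => ν) i).map_eq
  have hident : ∀ i : ℕ, IdentDistrib (fun ω : ℕ → α => X (ω i)) (fun ω => X (ω 0)) μ μ := by
    intro i
    refine IdentDistrib.comp (f := fun ω : ℕ → α => ω i) (g := fun ω : ℕ → α => ω 0)
      ⟨(measurable_pi_apply i).aemeasurable, (measurable_pi_apply 0).aemeasurable, ?_⟩ hXm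
    rw [hmap, hmap]
  have hint0 : ∀ g : α → ℝ, ∫ ω, g (ω 0) ∂μ = ∑ a, p a * g a := by
    intro g
    rw [← hint, ← hmap 0, integral_map (measurable_pi_apply 0).aemeasurable
      measurable_from_top.aestronglyMeasurable]
  have hclt := tendstoInDistribution_inv_sqrt_mul_sum (Y := id) (P' := gaussianReal 0 1)
    (X := fun (i : ℕ) (ω : ℕ → α) => X (ω i)) (P := μ) HasLaw.id
    (by rw [← h0]; exact hint0 X) (by rw [← h1]; exact hint0 fun a => X a ^ 2) hind hident
  have hnull : (gaussianReal 0 1).map id {c₀} = 0 := by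
    have := nullSingletonClass_gaussianReal (μ := 0) (v := 1) one_ne_zero
    simp
  have hlim := tendsto_measureReal_le_of_tendstoInDistribution hclt hc hnull
  rw [Measure.map_id, gaussianReal_real_Iic] at hlim
  refine hlim.congr fun n => ?_
  have hfin : μ.map (fun (ω : ℕ → α) (i : Fin n) => ω i) = Measure.pi fun _ => ν := by
    rw [← Measure.infinitePi_eq_pi]
    exact Measure.map_infinitePi_infinitePi_of_inj (P := fun _ : ℕ => ν) Fin.val_injective
  have hset : {ω : ℕ → α | (Real.sqrt n)⁻¹ * ∑ k ∈ Finset.range n, X (ω k) ≤ c n}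
      = (fun (ω : ℕ → α) (i : Fin n) => ω i) ⁻¹'
        {z | (Real.sqrt n)⁻¹ * ∑ i, X (z i) ≤ c n} := by
    ext ω
    simp only [Set.mem_ofPred_eq, Set.mem_preimage, Finset.sum_range]
  rw [hset, measureReal_def, ← Measure.map_apply (by fun_prop) (Set.toFinite _).measurableSet, hfin,
    ← measureReal_def, ← Finset.sum_filter]
  have hfil : {z : Fin n → α | (Real.sqrt n)⁻¹ * ∑ i, X (z i) ≤ c n}
      = ↑(Finset.univ.filter fun z : Fin n → α => (Real.sqrt n)⁻¹ * ∑ i, X (z i) ≤ c n) := by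
    ext z; simp
  rw [hfil, ← sum_measureReal_singleton]
  refine Finset.sum_congr rfl fun z _ => ?_
  rw [measureReal_def, Measure.pi_singleton, ENNReal.toReal_prod]
  refine Finset.prod_congr rfl fun i _ => ?_
  rw [hν, PMF.toMeasure_apply_singleton _ _ (measurableSet_singleton _), hq, PMF.ofFintype_apply,
    ENNReal.toReal_ofReal (hp _)]

end CentralLimit

/-! ### Independent sources and their information spectrum -/

section Iid

variable {𝒜 ℰ : Type*} [Fintype 𝒜]

theorem marginalE_iidDist (P : 𝒜 → ℰ → ℝ) (n : ℕ) (e : Fin n → ℰ) :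
    marginalE (iidDist P n) e = ∏ i, marginalE P (e i) := by
  classical
  simp only [marginalE, iidDist]
  exact (Fintype.prod_sum fun i a => P a (e i)).symm

theorem condProb_iidDist (P : 𝒜 → ℰ → ℝ) (n : ℕ) (a : Fin n → 𝒜) (e : Fin n → ℰ) :
    condProb (iidDist P n) a e = ∏ i, condProb P (a i) (e i) := by
  simp only [condProb, marginalE_iidDist, iidDist, Finset.prod_div_distrib]

theorem condProb_pos {P : 𝒜 → ℰ → ℝ} (hP : ∀ a e, 0 ≤ P a e) {a : 𝒜} {e : ℰ}
    (h : P a e ≠ 0) : 0 < condProb P a e := by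
  have h1 : 0 < P a e := (hP a e).lt_of_ne' h
  exact div_pos h1 (h1.trans_le (Finset.single_le_sum (fun a _ => hP a e) (Finset.mem_univ a)))

theorem condProb_le_one {P : 𝒜 → ℰ → ℝ} (hP : ∀ a e, 0 ≤ P a e) (a : 𝒜) (e : ℰ) :
    condProb P a e ≤ 1 :=
  div_le_one_of_le₀ (Finset.single_le_sum (fun a _ => hP a e) (Finset.mem_univ a))
    (Finset.sum_nonneg fun a _ => hP a e)

variable [Fintype ℰ]

theorem sum_iidDist (P : 𝒜 → ℰ → ℝ) (hP1 : ∑ a, ∑ e, P a e = 1) (n : ℕ) :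
    ∑ a, ∑ e, iidDist P n a e = 1 := by
  classical
  rw [← sum_marginalE]
  simp only [marginalE_iidDist]
  rw [← Fintype.prod_sum fun (_ : Fin n) e => marginalE P e, sum_marginalE, hP1]
  simp

/-- The conditional entropy is the mean of `-log P_{A|E}`. -/
theorem sum_mul_neg_log_condProb {P : 𝒜 → ℰ → ℝ} (hP : ∀ a e, 0 ≤ P a e) :
    ∑ a, ∑ e, P a e * -Real.log (condProb P a e) = condEntropy P := by
  have h1 : ∀ a e, P a e * -Real.log (condProb P a e)
      = Real.negMulLog (P a e) + P a e * Real.log (marginalE P e) := by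
    intro a e
    by_cases h : P a e = 0
    · simp [h]
    · have hm : marginalE P e ≠ 0 := by
        intro h0
        have := condProb_pos hP h
        simp [condProb, h0] at this
      rw [condProb, Real.log_div h hm, Real.negMulLog]
      ring
  simp only [h1, Finset.sum_add_distrib, condEntropy]
  rw [sub_eq_add_neg]
  congr 1
  rw [Finset.sum_comm, ← Finset.sum_neg_distrib]
  refine Finset.sum_congr rfl fun e _ => ?_
  rw [← Finset.sum_mul, Real.negMulLog, marginalE]
  ring

/-- If the mean of the nonnegative `-log P_{A|E}` were zero, that variable would vanish almost
surely and have no variance. Positivity makes `exp(nH + √n R)` tend to infinity for every real `R`.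
-/
theorem condEntropy_pos {P : 𝒜 → ℰ → ℝ} (hP : ∀ a e, 0 ≤ P a e) (hV : 0 < varentropy P) :
    0 < condEntropy P := by
  have hnn : ∀ a e, 0 ≤ P a e * -Real.log (condProb P a e) := by
    intro a e
    by_cases h : P a e = 0
    · simp [h]
    · exact mul_nonneg (hP a e) (neg_nonneg.2
        (Real.log_nonpos (condProb_pos hP h).le (condProb_le_one hP a e)))
  rcases (Finset.sum_nonneg fun a (_ : a ∈ Finset.univ) =>
    Finset.sum_nonneg fun e (_ : e ∈ Finset.univ) => hnn a e).eq_or_lt with h | h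
  · exfalso
    have hH : condEntropy P = 0 := by rw [← sum_mul_neg_log_condProb hP, ← h]
    have hz : ∀ a e, P a e * -Real.log (condProb P a e) = 0 := by
      intro a e
      have := (Finset.sum_eq_zero_iff_of_nonneg
        fun a _ => Finset.sum_nonneg fun e _ => hnn a e).1 h.symm a (Finset.mem_univ a)
      exact (Finset.sum_eq_zero_iff_of_nonneg fun e _ => hnn a e).1 this e (Finset.mem_univ e)
    have : varentropy P = 0 := by
      refine Finset.sum_eq_zero fun a _ => Finset.sum_eq_zero fun e _ => ?_
      rw [hH, sub_zero, sq, ← mul_assoc, hz, zero_mul]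
    exact hV.ne' this
  · rwa [sum_mul_neg_log_condProb hP] at h

/-- Second order asymptotics of the information spectrum of an i.i.d. source. -/
theorem tendsto_largeMass_iidDist {P : 𝒜 → ℰ → ℝ} (hP : ∀ a e, 0 ≤ P a e)
    (hP1 : ∑ a, ∑ e, P a e = 1) (hV : 0 < varentropy P) {s : ℕ → ℝ} {R : ℝ}
    (hs : Tendsto (fun n : ℕ => (s n - n * condEntropy P) / Real.sqrt n) atTop (𝓝 R)) :
    Tendsto (fun n => largeMass (iidDist P n) (Real.exp (-s n))) atTop
      (𝓝 (∫ x in Set.Iic (R / Real.sqrt (varentropy P)),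
        1 / Real.sqrt (2 * Real.pi) * Real.exp (-x ^ 2 / 2))) := by
  classical
  have hσ : 0 < Real.sqrt (varentropy P) := Real.sqrt_pos.2 hV
  set σ := Real.sqrt (varentropy P) with hσdef
  set H := condEntropy P with hH
  have h0 : ∑ z : 𝒜 × ℰ, P z.1 z.2 * ((-Real.log (condProb P z.1 z.2) - H) / σ) = 0 := by
    have : ∀ a e, P a e * ((-Real.log (condProb P a e) - H) / σ)
        = (P a e * -Real.log (condProb P a e) - P a e * H) / σ := fun a e => by ring
    rw [Fintype.sum_prod_type]
    simp only [this, ← Finset.sum_div, Finset.sum_sub_distrib, ← Finset.sum_mul]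
    rw [sum_mul_neg_log_condProb hP, hP1, ← hH]
    simp
  have h1 : ∑ z : 𝒜 × ℰ, P z.1 z.2 * ((-Real.log (condProb P z.1 z.2) - H) / σ) ^ 2 = 1 := by
    have : ∀ a e, P a e * ((-Real.log (condProb P a e) - H) / σ) ^ 2
        = P a e * (-Real.log (condProb P a e) - H) ^ 2 / varentropy P := fun a e => by
      rw [div_pow, hσdef, Real.sq_sqrt hV.le]; ring
    rw [Fintype.sum_prod_type]
    simp only [this, ← Finset.sum_div]
    exact div_self hV.ne'
  have hclt := tendsto_sum_prod_clt (fun z : 𝒜 × ℰ => hP z.1 z.2)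
    (by rw [Fintype.sum_prod_type]; exact hP1) h0 h1 (hs.div_const σ)
  refine hclt.congr' ?_
  filter_upwards [eventually_gt_atTop 0] with n hn
  have hn' : 0 < Real.sqrt n := Real.sqrt_pos.2 (by exact_mod_cast hn)
  rw [largeMass, ← Fintype.sum_prod_type',
    ← (Equiv.arrowProdEquivProdArrow (Fin n) (fun _ => 𝒜) (fun _ => ℰ)).sum_comp]
  refine Finset.sum_congr rfl fun z _ => ?_
  simp only [Equiv.arrowProdEquivProdArrow, Equiv.coe_fn_mk, iidDist]
  change _ = if _ ≤ condProb (iidDist P n) (fun i => (z i).1) (fun i => (z i).2) then _ else _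
  rw [condProb_iidDist]
  -- Null sequences contribute zero on both sides. Elsewhere all conditional probabilities are
  -- positive, so taking logarithms turns the threshold event into one on the normalised sum.
  by_cases hz : ∏ i, P (z i).1 (z i).2 = 0
  · simp [hz]
  · have hc : ∀ i, 0 < condProb P (z i).1 (z i).2 := fun i =>
      condProb_pos hP (Finset.prod_ne_zero_iff.1 hz i (Finset.mem_univ i))
    refine if_congr ?_ rfl rfl
    rw [← Real.le_log_iff_exp_le (Finset.prod_pos fun i _ => hc i),
      Real.log_prod (fun i _ => (hc i).ne'), ← Finset.sum_div, Finset.sum_sub_distrib,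
      Finset.sum_neg_distrib, Finset.sum_const, Finset.card_univ, Fintype.card_fin, nsmul_eq_mul,
      ← mul_div_assoc, div_le_div_iff_of_pos_right hσ, inv_mul_le_iff₀ hn',
      mul_div_cancel₀ _ hn'.ne']
    constructor <;> intro h <;> linarith

end Iid

/-! ### The slack `n^{1/4}` and the rounding of the key size -/

section Asymptotics

theorem tendsto_sqrt_sqrt_atTop :
    Tendsto (fun n : ℕ => Real.sqrt (Real.sqrt n)) atTop atTop :=
  Real.tendsto_sqrt_atTop.comp (Real.tendsto_sqrt_atTop.comp tendsto_natCast_atTop_atTop)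

theorem tendsto_sqrt_sqrt_div_sqrt :
    Tendsto (fun n : ℕ => Real.sqrt (Real.sqrt n) / Real.sqrt n) atTop (𝓝 0) := by
  refine (tendsto_inv_atTop_zero.comp tendsto_sqrt_sqrt_atTop).congr fun n => ?_
  have h := Real.mul_self_sqrt (Real.sqrt_nonneg (n : ℝ))
  rw [Function.comp_apply]
  nth_rewrite 3 [← h]
  exact (div_self_mul_self' _).symm

/-- The slack in the thresholds is `o(√n)`, hence invisible to the second order rate. -/
theorem tendsto_add_sqrt_sqrt {s : ℕ → ℝ} {H R : ℝ}
    (hs : Tendsto (fun n : ℕ => (s n - n * H) / Real.sqrt n) atTop (𝓝 R)) (c : ℝ) :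
    Tendsto (fun n : ℕ => (s n + c * Real.sqrt (Real.sqrt n) - n * H) / Real.sqrt n) atTop
      (𝓝 R) := by
  have := hs.add (tendsto_sqrt_sqrt_div_sqrt.const_mul c)
  rw [mul_zero, add_zero] at this
  exact this.congr fun n => by ring

/-- With `x = n^{1/4}` this is the decay of `p(x⁴) / exp x`. -/
theorem tendsto_sqrt_polynomial_mul_exp (p : Polynomial ℝ) :
    Tendsto (fun n : ℕ => Real.sqrt (|p.eval (n : ℝ)| * Real.exp (-Real.sqrt (Real.sqrt n)))) atTop
      (𝓝 0) := by
  have h := ((p.comp (Polynomial.X ^ 4)).tendsto_div_exp_atTop.comp tendsto_sqrt_sqrt_atTop).abs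
  have h2 := (Real.continuous_sqrt.tendsto _).comp h
  rw [abs_zero, Real.sqrt_zero] at h2
  refine h2.congr fun n => ?_
  have h4 : Real.sqrt (Real.sqrt n) ^ 4 = (n : ℝ) := by
    rw [show 4 = 2 * 2 from rfl, pow_mul, Real.sq_sqrt (Real.sqrt_nonneg _),
      Real.sq_sqrt (Nat.cast_nonneg n)]
  simp only [Function.comp_apply, Polynomial.eval_comp, Polynomial.eval_pow, Polynomial.eval_X, h4]
  rw [abs_div, abs_of_pos (Real.exp_pos _), Real.exp_neg, div_eq_mul_inv]

theorem mul_exp_neg_log_add {M : ℝ} (hM : 0 < M) (r : ℝ) :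
    M * Real.exp (-(Real.log M + r)) = Real.exp (-r) := by
  rw [neg_add, Real.exp_add, Real.exp_neg, Real.exp_log hM, ← mul_assoc, mul_inv_cancel₀ hM.ne',
    one_mul]

/-- Since `⌊x⌋ / x → 1` as `x → ∞`, rounding changes the logarithm by `o(1)`. -/
theorem tendsto_log_floor_exp {u : ℕ → ℝ} (hu : Tendsto u atTop atTop) :
    Tendsto (fun n => Real.log ⌊Real.exp (u n)⌋₊ - u n) atTop (𝓝 0) := by
  have h1 : Tendsto (fun n => (⌊Real.exp (u n)⌋₊ : ℝ) / Real.exp (u n)) atTop (𝓝 1) :=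
    (tendsto_nat_floor_div_atTop (R := ℝ)).comp (Real.tendsto_exp_atTop.comp hu)
  have h2 := (Real.continuousAt_log one_ne_zero).tendsto.comp h1
  rw [Real.log_one] at h2
  refine h2.congr' ?_
  filter_upwards [hu.eventually_ge_atTop 0] with n hn
  have h3 : 0 < ⌊Real.exp (u n)⌋₊ := Nat.floor_pos.2 (Real.one_le_exp hn)
  rw [Function.comp_apply, Real.log_div (by exact_mod_cast h3.ne') (Real.exp_pos _).ne',
    Real.log_exp]

end Asymptotics

/-! ### Asymptotics of the optimal function -/

section Optimal

variable {𝒜 ℰ : Type*} [Fintype 𝒜] [Fintype ℰ]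

/-- The converse bound at the threshold `exp (-(log M - r))`. -/
theorem converse_exp {ℬ : Type*} [Fintype ℬ] [Nonempty ℬ] {P : 𝒜 → ℰ → ℝ}
    (hP : ∀ a e, 0 ≤ P a e) (hP1 : ∑ a, ∑ e, P a e = 1) (r : ℝ) (f : 𝒜 → ℬ) :
    2 * (largeMass P (Real.exp (-(Real.log (Fintype.card ℬ) + (-1) * r))) - Real.exp (-r))
      ≤ d1' (keyDist f P) := by
  have hM : (0 : ℝ) < Fintype.card ℬ := by exact_mod_cast Fintype.card_pos
  have h := two_mul_largeMass_sub_le_d1' hP hP1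
    (Real.exp_pos (-(Real.log (Fintype.card ℬ) + (-1) * r))) f
  have h1 : 1 / Real.exp (-(-1 * r)) = Real.exp (-r) := by
    rw [one_div, ← Real.exp_neg]; ring_nf
  rwa [mul_exp_neg_log_add hM, h1] at h

/-- The minimum is at most the average over uniformly random functions. -/
theorem minD1'_le_sqrt_add {ℬ : Type*} [Fintype ℬ] [Nonempty ℬ] {P : 𝒜 → ℰ → ℝ}
    (hP : ∀ a e, 0 ≤ P a e) (hP1 : ∑ a, ∑ e, P a e = 1) {t : ℝ} (ht : 0 < t) :
    minD1' ℬ P ≤ Real.sqrt (Fintype.card ℬ * t) + 2 * largeMass P t := by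
  classical
  have hN : (0 : ℝ) < Fintype.card (𝒜 → ℬ) := by exact_mod_cast Fintype.card_pos
  have havg := sum_mul_d1'_truncDist_le (p := fun _ : 𝒜 → ℬ => (Fintype.card (𝒜 → ℬ) : ℝ)⁻¹)
    (f := fun f => f) (fun _ => by positivity)
    (by rw [Finset.sum_const, Finset.card_univ, nsmul_eq_mul, mul_inv_cancel₀ hN.ne'])
    zero_le_one hasMeanSquareBound_uniform hP hP1 ht
  rw [one_mul] at havg
  have hmin : ∀ f : 𝒜 → ℬ, minD1' ℬ P ≤ d1' (keyDist f (truncDist P t)) + 2 * largeMass P t :=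
    fun f => (ciInf_le (Set.finite_range _).bddBelow f).trans (d1'_keyDist_le_truncDist hP t f)
  have h1 : ∑ _f : 𝒜 → ℬ, (Fintype.card (𝒜 → ℬ) : ℝ)⁻¹ * (minD1' ℬ P - 2 * largeMass P t)
      ≤ ∑ f : 𝒜 → ℬ, (Fintype.card (𝒜 → ℬ) : ℝ)⁻¹ * d1' (keyDist f (truncDist P t)) := by
    refine Finset.sum_le_sum fun f _ => mul_le_mul_of_nonneg_left ?_ (by positivity)
    linarith [hmin f]
  rw [Finset.sum_const, Finset.card_univ, nsmul_eq_mul, mul_inv_cancel_left₀ hN.ne'] at h1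
  linarith

omit [Fintype 𝒜] [Fintype ℰ] in
theorem iidDist_nonneg {P : 𝒜 → ℰ → ℝ} (hP : ∀ a e, 0 ≤ P a e) (n : ℕ) (a : Fin n → 𝒜)
    (e : Fin n → ℰ) : 0 ≤ iidDist P n a e :=
  Finset.prod_nonneg fun _ _ => hP _ _

/-- Second order asymptotics of the converse bound. -/
theorem tendsto_converse {P : 𝒜 → ℰ → ℝ} (hP : ∀ a e, 0 ≤ P a e)
    (hP1 : ∑ a, ∑ e, P a e = 1) (hV : 0 < varentropy P) {s : ℕ → ℝ} {R : ℝ}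
    (hs : Tendsto (fun n : ℕ => (s n - n * condEntropy P) / Real.sqrt n) atTop (𝓝 R)) :
    Tendsto (fun n : ℕ => 2 * (largeMass (iidDist P n)
        (Real.exp (-(s n + (-1) * Real.sqrt (Real.sqrt n))))
          - Real.exp (-Real.sqrt (Real.sqrt n)))) atTop
      (𝓝 (2 * ∫ x in Set.Iic (R / Real.sqrt (varentropy P)),
        1 / Real.sqrt (2 * Real.pi) * Real.exp (-x ^ 2 / 2))) := by
  have h1 := tendsto_largeMass_iidDist hP hP1 hV (tendsto_add_sqrt_sqrt hs (-1))
  have h2 := Real.tendsto_exp_neg_atTop_nhds_zero.comp tendsto_sqrt_sqrt_atTop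
  simpa using (h1.sub h2).const_mul 2

/-- Second order asymptotics of the direct bound. -/
theorem tendsto_direct {P : 𝒜 → ℰ → ℝ} (hP : ∀ a e, 0 ≤ P a e)
    (hP1 : ∑ a, ∑ e, P a e = 1) (hV : 0 < varentropy P) {s : ℕ → ℝ} {R : ℝ}
    (hs : Tendsto (fun n : ℕ => (s n - n * condEntropy P) / Real.sqrt n) atTop (𝓝 R))
    (p : Polynomial ℝ) :
    Tendsto (fun n : ℕ =>
      Real.sqrt (|p.eval (n : ℝ)| * Real.exp (-Real.sqrt (Real.sqrt n))) + 2 *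
        largeMass (iidDist P n) (Real.exp (-(s n + Real.sqrt (Real.sqrt n))))) atTop
      (𝓝 (2 * ∫ x in Set.Iic (R / Real.sqrt (varentropy P)),
        1 / Real.sqrt (2 * Real.pi) * Real.exp (-x ^ 2 / 2))) := by
  have h1 := tendsto_largeMass_iidDist hP hP1 hV (tendsto_add_sqrt_sqrt hs 1)
  simp only [one_mul] at h1
  simpa only [zero_add] using (tendsto_sqrt_polynomial_mul_exp p).add (h1.const_mul 2)

/-- Second order asymptotics of the optimal distinguishability. -/
theorem tendsto_minD1' {P : 𝒜 → ℰ → ℝ} (hP : ∀ a e, 0 ≤ P a e)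
    (hP1 : ∑ a, ∑ e, P a e = 1) (hV : 0 < varentropy P) {R : ℝ}
    {ℬ : ℕ → Type*} [∀ n, Fintype (ℬ n)] (hne : ∀ᶠ n in atTop, Nonempty (ℬ n))
    (hs : Tendsto (fun n : ℕ => (Real.log (Fintype.card (ℬ n)) - n * condEntropy P) / Real.sqrt n)
      atTop (𝓝 R)) :
    Tendsto (fun n : ℕ => minD1' (ℬ n) (iidDist P n)) atTop
      (𝓝 (2 * ∫ x in Set.Iic (R / Real.sqrt (varentropy P)),
        1 / Real.sqrt (2 * Real.pi) * Real.exp (-x ^ 2 / 2))) := by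
  refine tendsto_of_tendsto_of_tendsto_of_le_of_le' (tendsto_converse hP hP1 hV hs)
    (tendsto_direct hP hP1 hV hs 1) ?_ ?_
  · filter_upwards [hne] with n hn
    exact le_ciInf fun f => converse_exp (iidDist_nonneg hP n) (sum_iidDist P hP1 n) _ f
  · filter_upwards [hne] with n hn
    have hM : (0 : ℝ) < Fintype.card (ℬ n) := by exact_mod_cast Fintype.card_pos
    have := minD1'_le_sqrt_add (ℬ := ℬ n) (iidDist_nonneg hP n) (sum_iidDist P hP1 n)
      (Real.exp_pos (-(Real.log (Fintype.card (ℬ n)) + Real.sqrt (Real.sqrt n))))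
    rw [mul_exp_neg_log_add hM] at this
    simpa using this

end Optimal

/-! ### Expectation over a random linear function -/

section RandomHash

/-- The expectation of a function of a random element of a finite set. -/
theorem integral_comp_eq_sum {Ω Φ : Type*} [MeasurableSpace Ω] [Fintype Φ] (μ : Measure Ω)
    [IsProbabilityMeasure μ] {f : Ω → Φ} (hf : ∀ g, MeasurableSet {ω | f ω = g}) (d : Φ → ℝ) :
    ∫ ω, d (f ω) ∂μ = ∑ φ, μ.real {ω | f ω = φ} * d φ := by
  let _ : MeasurableSpace Φ := ⊤
  have : MeasurableSingletonClass Φ := ⟨fun _ => trivial⟩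
  have hfm : Measurable f := measurable_to_countable' fun g => hf g
  have := Measure.isProbabilityMeasure_map (μ := μ) hfm.aemeasurable
  rw [← integral_map hfm.aemeasurable measurable_from_top.aestronglyMeasurable,
    integral_fintype Integrable.of_finite]
  refine Finset.sum_congr rfl fun φ _ => ?_
  rw [measureReal_def, Measure.map_apply hfm (measurableSet_singleton φ), smul_eq_mul]
  rfl

theorem measureReal_eq_sum {Ω Φ : Type*} [MeasurableSpace Ω] [Fintype Φ] (μ : Measure Ω)
    [IsProbabilityMeasure μ] {f : Ω → Φ} (hf : ∀ g, MeasurableSet {ω | f ω = g}) (Q : Φ → Prop) :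
    μ.real {ω | Q (f ω)} = ∑ φ, open Classical in if Q φ then μ.real {ω | f ω = φ} else 0 := by
  classical
  have hQ : {ω | Q (f ω)} = ⋃ φ ∈ Finset.univ.filter Q, {ω | f ω = φ} := by
    ext ω; simp
  rw [hQ, measureReal_biUnion_finset, Finset.sum_filter]
  · intro φ _ φ' _ hne
    refine Set.disjoint_left.2 fun ω h h' => hne ?_
    exact (show f ω = φ from h).symm.trans h'
  · exact fun φ _ => hf φ

variable {F : Type*} [Field F] [Fintype F] {n k m : ℕ} {ℰ : Type*} [Fintype ℰ]
  {Ω : Type*} [MeasurableSpace Ω]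

/-- The expected distinguishability of an almost dual universal random linear function. -/
theorem integral_d1'_le (μ : Measure Ω) [IsProbabilityMeasure μ]
    {f : Ω → (Fin n → Fin k → F) →ₗ[F] (Fin m → F)} (hf : ∀ g, MeasurableSet {ω | f ω = g})
    {ε : ℝ} (hdual : IsAlmostDualUniversalHash μ f ε)
    {P : (Fin n → Fin k → F) → ℰ → ℝ} (hP : ∀ a e, 0 ≤ P a e) (hP1 : ∑ a, ∑ e, P a e = 1)
    {t : ℝ} (ht : 0 < t) :
    ∫ ω, d1' (keyDist (f ω) P) ∂μ ≤ (Real.sqrt (|ε| * (Fintype.card (Fin m → F) * t))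
      + 2 * largeMass P t) + 2 * (1 - μ.real {ω | Function.Surjective (f ω)}) := by
  classical
  have : Finite ((Fin n → Fin k → F) →ₗ[F] (Fin m → F)) :=
    Finite.of_injective _ DFunLike.coe_injective
  have := Fintype.ofFinite ((Fin n → Fin k → F) →ₗ[F] (Fin m → F))
  rw [integral_comp_eq_sum μ hf fun φ => d1' (keyDist φ P)]
  set w : ((Fin n → Fin k → F) →ₗ[F] (Fin m → F)) → ℝ := fun φ => μ.real {ω | f ω = φ} with hw
  have hw0 : ∀ φ, 0 ≤ w φ := fun φ => measureReal_nonneg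
  have hw1 : ∑ φ, w φ = 1 := by
    have := measureReal_eq_sum μ hf fun _ => True
    simpa [probReal_univ] using this.symm
  -- Discarding the non-surjective functions leaves a subprobability weight, still dual universal;
  -- the missing mass is charged at the trivial bound `2`.
  set p : ((Fin n → Fin k → F) →ₗ[F] (Fin m → F)) → ℝ :=
    fun φ => if Function.Surjective φ then w φ else 0 with hp
  have hp0 : ∀ φ, 0 ≤ p φ := by
    intro φ
    simp only [hp]
    split_ifs
    · exact hw0 φ
    · exact le_rfl
  have hpw : ∀ φ, p φ ≤ w φ := by
    intro φ
    simp only [hp]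
    split_ifs
    · exact le_rfl
    · exact hw0 φ
  have hpsurj : ∑ φ, p φ = μ.real {ω | Function.Surjective (f ω)} := by
    convert (measureReal_eq_sum μ hf fun φ => Function.Surjective φ).symm
  have hq : (0 : ℝ) < Fintype.card F := by exact_mod_cast Fintype.card_pos
  have hmsb : HasMeanSquareBound p (fun φ => ⇑φ) |ε| := by
    refine hasMeanSquareBound_of_dual hp0 ?_ (abs_nonneg ε) ?_
    · intro φ hφ
      by_contra h
      exact hφ (if_neg h)
    · intro x hx
      have h1 := hdual.2 x hx
      rw [measureReal_eq_sum μ hf fun φ => x ∈ dualCode (LinearMap.ker φ)] at h1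
      -- The exponent is `m - nk`, written as the definitions unfold it.
      have h2 : (∑ φ, if x ∈ dualCode (LinearMap.ker φ) then p φ else 0)
          ≤ (Fintype.card F : ℝ) ^ (((n * k : ℕ) : ℤ) - ((n * k : ℕ) - (m : ℤ)) - (n * k : ℕ)) * ε := by
        refine le_trans (Finset.sum_le_sum fun φ _ => ?_) h1
        split_ifs
        · exact hpw φ
        · exact le_rfl
      have hcm : (Fintype.card (Fin m → F) : ℝ) = (Fintype.card F : ℝ) ^ m := by
        simp
      have hcn : (Fintype.card (Fin n → Fin k → F) : ℝ) = (Fintype.card F : ℝ) ^ (n * k) := by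
        simp [← pow_mul, mul_comm]
      have hpow : (Fintype.card F : ℝ) ^ (((n * k : ℕ) : ℤ) - ((n * k : ℕ) - (m : ℤ)) - (n * k : ℕ))
          * (Fintype.card F : ℝ) ^ (n * k) = (Fintype.card F : ℝ) ^ m := by
        rw [← zpow_natCast, ← zpow_natCast, ← zpow_add₀ hq.ne']
        congr 1
        ring
      calc _ ≤ (Fintype.card F : ℝ) ^ (((n * k : ℕ) : ℤ) - ((n * k : ℕ) - (m : ℤ)) - (n * k : ℕ))
            * ε * Fintype.card (Fin n → Fin k → F) := by gcongr
        _ = (Fintype.card F : ℝ) ^ m * ε := by rw [hcn, mul_right_comm, hpow]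
        _ ≤ |ε| * Fintype.card (Fin m → F) := by
          rw [hcm, mul_comm]
          gcongr
          exact le_abs_self ε
  have hp1 : ∑ φ, p φ ≤ 1 := hw1 ▸ Finset.sum_le_sum fun φ _ => hpw φ
  have hhash := sum_mul_d1'_truncDist_le hp0 hp1 (abs_nonneg ε) hmsb hP hP1 ht
  have hL : 0 ≤ largeMass P t := by
    refine Finset.sum_nonneg fun a _ => Finset.sum_nonneg fun e _ => ?_
    split_ifs
    · exact hP a e
    · exact le_rfl
  calc ∑ φ, w φ * d1' (keyDist φ P)
      ≤ ∑ φ, (p φ * d1' (keyDist φ (truncDist P t)) + p φ * (2 * largeMass P t)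
          + (w φ - p φ) * 2) := by
        refine Finset.sum_le_sum fun φ _ => ?_
        have h1 := mul_le_mul_of_nonneg_left (d1'_keyDist_le_truncDist hP t φ) (hp0 φ)
        have h2 := mul_le_mul_of_nonneg_left (d1'_keyDist_le_two hP hP1 φ)
          (sub_nonneg.2 (hpw φ))
        linarith
    _ = ∑ φ, p φ * d1' (keyDist φ (truncDist P t)) + (∑ φ, p φ) * (2 * largeMass P t)
          + (1 - ∑ φ, p φ) * 2 := by
        rw [Finset.sum_add_distrib, Finset.sum_add_distrib, ← Finset.sum_mul, ← Finset.sum_mul,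
          Finset.sum_sub_distrib, hw1]
    _ ≤ _ := by
        have h3 : (∑ φ, p φ) * (2 * largeMass P t) ≤ 1 * (2 * largeMass P t) := by gcongr
        rw [← hpsurj]
        linarith

/-- Every realisation is a deterministic function, so a converse valid for all functions passes to
the mean. -/
theorem le_integral_d1' (μ : Measure Ω) [IsProbabilityMeasure μ]
    {f : Ω → (Fin n → Fin k → F) →ₗ[F] (Fin m → F)} (hf : ∀ g, MeasurableSet {ω | f ω = g})
    {P : (Fin n → Fin k → F) → ℰ → ℝ} {c : ℝ}
    (hc : ∀ φ : (Fin n → Fin k → F) → (Fin m → F), c ≤ d1' (keyDist φ P)) :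
    c ≤ ∫ ω, d1' (keyDist (f ω) P) ∂μ := by
  have : Finite ((Fin n → Fin k → F) →ₗ[F] (Fin m → F)) :=
    Finite.of_injective _ DFunLike.coe_injective
  have := Fintype.ofFinite ((Fin n → Fin k → F) →ₗ[F] (Fin m → F))
  rw [integral_comp_eq_sum μ hf fun φ => d1' (keyDist φ P)]
  have hw1 : ∑ φ, μ.real {ω | f ω = φ} = 1 := by
    simpa [probReal_univ] using (measureReal_eq_sum μ hf fun _ => True).symm
  calc c = ∑ φ, μ.real {ω | f ω = φ} * c := by rw [← Finset.sum_mul, hw1, one_mul]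
    _ ≤ _ := Finset.sum_le_sum fun φ _ => mul_le_mul_of_nonneg_left (hc φ) measureReal_nonneg

end RandomHash

end

end KeyHash

/-! ### Assembly of the three limits -/

open KeyHash
theorem mainTheorem11
    -- the field with `q` elements, the alphabet `F^k` of `A`, the alphabet of `E`
    {F : Type*} [Field F] [Fintype F] {k : ℕ} {ℰ : Type*} [Fintype ℰ]
    -- the joint distribution of `(A, E)`
    (P : (Fin k → F) → ℰ → ℝ) (hP_nonneg : ∀ a e, 0 ≤ P a e) (hP_sum : ∑ a, ∑ e, P a e = 1)
    (hV : 0 < varentropy P) (R : ℝ)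
    -- the key lengths: `m n * log q = n H(A|E) + √n R + o(√n)`
    (m : ℕ → ℕ)
    (hm : Tendsto (fun n : ℕ => ((m n : ℝ) * Real.log (Fintype.card F) - n * condEntropy P) /
      Real.sqrt n) atTop (𝓝 R))
    -- the random linear functions `f n` from `(F^k)^n` to `F^(m n)`
    {Ω : ℕ → Type*} [∀ n, MeasurableSpace (Ω n)]
    (μ : ∀ n, Measure (Ω n)) [∀ n, IsProbabilityMeasure (μ n)]
    (f : ∀ n, Ω n → (Fin n → Fin k → F) →ₗ[F] (Fin (m n) → F))
    (hf_meas : ∀ n g, MeasurableSet {ω | f n ω = g})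
    (hf_surj : Tendsto (fun n => (μ n).real {ω | Function.Surjective (f n ω)}) atTop (𝓝 1))
    (p : Polynomial ℝ)
    (hf_dual : ∀ n : ℕ, IsAlmostDualUniversalHash (μ n) (f n) (p.eval (n : ℝ))) :
    Tendsto (fun n => ∫ ω, d1' (keyDist (f n ω) (iidDist P n)) ∂(μ n)) atTop
      (𝓝 (2 * ∫ x in Set.Iic (R / Real.sqrt (varentropy P)),
        1 / Real.sqrt (2 * Real.pi) * Real.exp (-x ^ 2 / 2))) ∧
    Tendsto (fun n : ℕ =>
        minD1' (Fin ⌊Real.exp (n * condEntropy P + Real.sqrt n * R)⌋₊) (iidDist P n)) atTop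
      (𝓝 (2 * ∫ x in Set.Iic (R / Real.sqrt (varentropy P)),
        1 / Real.sqrt (2 * Real.pi) * Real.exp (-x ^ 2 / 2))) ∧
    Tendsto (fun n : ℕ => minD1' (Fin (m n) → F) (iidDist P n)) atTop
      (𝓝 (2 * ∫ x in Set.Iic (R / Real.sqrt (varentropy P)),
        1 / Real.sqrt (2 * Real.pi) * Real.exp (-x ^ 2 / 2))) := by
  have hcard : ∀ n, Real.log (Fintype.card (Fin (m n) → F)) = m n * Real.log (Fintype.card F) := by
    intro n
    rw [Fintype.card_fun, Fintype.card_fin, Nat.cast_pow, Real.log_pow]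
  have hs : Tendsto (fun n : ℕ => (Real.log (Fintype.card (Fin (m n) → F)) - n * condEntropy P) /
      Real.sqrt n) atTop (𝓝 R) := by
    simpa only [hcard] using hm
  have hH := condEntropy_pos hP_nonneg hV
  refine ⟨?_, ?_, tendsto_minD1' hP_nonneg hP_sum hV (Eventually.of_forall fun n => inferInstance) hs⟩
  · have hup := (tendsto_direct hP_nonneg hP_sum hV hs p).add
      ((hf_surj.const_sub 1).const_mul 2)
    rw [sub_self, mul_zero, add_zero] at hup
    refine tendsto_of_tendsto_of_tendsto_of_le_of_le
      (tendsto_converse hP_nonneg hP_sum hV hs) hup (fun n => ?_) (fun n => ?_)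
    · exact le_integral_d1' (μ n) (hf_meas n) fun φ =>
        converse_exp (iidDist_nonneg hP_nonneg n) (sum_iidDist P hP_sum n) _ φ
    · have hM : (0 : ℝ) < Fintype.card (Fin (m n) → F) := by exact_mod_cast Fintype.card_pos
      have := integral_d1'_le (μ n) (hf_meas n) (hf_dual n) (iidDist_nonneg hP_nonneg n)
        (sum_iidDist P hP_sum n)
        (Real.exp_pos (-(Real.log (Fintype.card (Fin (m n) → F)) + Real.sqrt (Real.sqrt n))))
      rwa [mul_exp_neg_log_add hM] at this
  · have hsqrt : Tendsto (fun n : ℕ => Real.sqrt n) atTop atTop :=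
      Real.tendsto_sqrt_atTop.comp tendsto_natCast_atTop_atTop
    have hu : Tendsto (fun n : ℕ => n * condEntropy P + Real.sqrt n * R) atTop atTop := by
      have h1 : Tendsto (fun n : ℕ => Real.sqrt n * condEntropy P + R) atTop atTop :=
        tendsto_atTop_add_const_right _ _ (hsqrt.atTop_mul_const hH)
      -- Factored as `√n (√n H + R)`, so a negative `R` does no harm.
      refine (hsqrt.atTop_mul_atTop₀ h1).congr fun n => ?_
      have := Real.mul_self_sqrt (Nat.cast_nonneg (α := ℝ) n)
      linear_combination condEntropy P * this
    refine tendsto_minD1' hP_nonneg hP_sum hV ?_ ?_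
    -- For small `n` the floor may be `0` and the key set empty, hence only eventual nonemptiness.
    · filter_upwards [hu.eventually_ge_atTop 0] with n hn
      exact Fin.pos_iff_nonempty.1 (Nat.floor_pos.2 (Real.one_le_exp hn))
    · simp only [Fintype.card_fin]
      have h1 := (tendsto_log_floor_exp hu).div_atTop hsqrt
      have h2 := h1.add_const R
      rw [zero_add] at h2
      refine h2.congr' ?_
      filter_upwards [eventually_gt_atTop 0] with n hn
      have : Real.sqrt n ≠ 0 := (Real.sqrt_pos.2 (by exact_mod_cast hn)).ne'
      field_simp
      ring
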